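/- Let $D$ be an integral domain with quotient field $K$. For a nonzero fractional ideal $A$ of $D$ let $A^{-1}=\{x\in K: xA\subseteq D\}$, $A_v=(A^{-1})^{-1}$, and let $A_t=\bigcup I_v$, where $I$ ranges over the nonzero finitely generated fractional ideals contained in $A$. A *$t$-ideal* is a nonzero ideal $I\subseteq D$ with $I_t=I$; a *maximal $t$-ideal* is one that is maximal among the proper $t$-ideals; $I$ is *$t$-invertible* if it is nonzero and $(II^{-1})_t=D$. $D$ is *$t$-treed* if any two prime $t$-ideals contained in a common prime $t$-ideal are comparable. An ideal $I$ of $D$ is a *valuation ideal* if $IV\cap D=I$ for some valuation ring $V$ with $D\subseteq V\subseteq K$ and quotient field $K$. An ideal $I$ is a *finite $t$-product of valuation ideals* if $I=(I_1\cdots I_n)_t$ for some $n\ge 1$ and valuation ideals $I_1,\dots,I_n$ of $D$. $D$ is a *$t$-VIFD* if each nonzero principal ideal is a finite $t$-product of valuation ideals, and a *VFD* if each nonzero nonunit is a finite product of nonzero nonunits $a$ for which $aD$ is a valuation ideal. $D$ is a *P$v$MD* (resp., *Prüfer domain*) if each nonzero finitely generated ideal is $t$-invertible (resp., invertible). $D$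 is *weakly Matlis* (resp., *h-local*) if each nonzero nonunit lies in only finitely many maximal $t$-ideals (resp., maximal ideals) and each prime $t$-ideal (resp., nonzero prime ideal) lies in a unique maximal $t$-ideal (resp., maximal ideal). An *independent ring of Krull type* is a weakly Matlis P$v$MD. $D$ is a *UMT-domain* if each nonzero prime ideal $Q$ of $D[X]$ with $Q\cap D=(0)$ is a maximal $t$-ideal of $D[X]$. For $f\in D[X]$ let $c(f)$ be the ideal of $D$ generated by the coefficients of $f$, and let $N_v=\{f\in D[X]: f\ne 0,\ c(f)_v=D\}$, a multiplicatively closed set. **Theorem 4.5.** Let $D$ be a $t$-treed domain. The following statements are equivalent. 1. Every nonzero $t$-ideal of $D$ is a finite $t$-product of valuation ideals. 2. $D$ is a $t$-VIFD. 3. $D$ is an independent ring of Krull type. 4. $D[X]$ is an independent ring of Krull type. 5. $D[X]$ is a $t$-VIFD and $D$ is a UMT-domain. 6. $D[X]_{N_v}$ is a VFD and $D$ is a UMT-domain. 7. $D[X]_{N_v}$ is an h-local Prüfer domain. 8. Every nonzero prime ideal of $D$ contains a $t$-invertible valuation ideal. -/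

import Mathlib

open Polynomial nonZeroDivisors

namespace TIdeals

noncomputable section

section Closures

variable {R : Type*} [CommRing R] [IsDomain R] {K : Type*} [Field K] [Algebra R K]
  [IsFractionRing R K]

/-- The `v`-closure `A_v = (A⁻¹)⁻¹` of a fractional ideal (with `0_v = 0`). -/
def vClosure (A : FractionalIdeal R⁰ K) : FractionalIdeal R⁰ K := (A⁻¹)⁻¹

theorem inv_ne_zero_of_ne_zero {A : FractionalIdeal R⁰ K} (hA : A ≠ 0) : A⁻¹ ≠ 0 := by
  obtain ⟨d, hd, hdA⟩ := A.isFractional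
  intro h
  have hd' : algebraMap R K d ∈ A⁻¹ := by
    rw [FractionalIdeal.mem_inv_iff hA]
    intro y hy
    obtain ⟨r, hr⟩ := hdA y hy
    rw [FractionalIdeal.mem_one_iff]
    exact ⟨r, by rw [hr, Algebra.smul_def]⟩
  rw [h, FractionalIdeal.mem_zero_iff] at hd'
  exact nonZeroDivisors.ne_zero hd ((map_eq_zero_iff _ (IsFractionRing.injective R K)).1 hd')

theorem vClosure_mono {A B : FractionalIdeal R⁰ K} (h : A ≤ B) : vClosure A ≤ vClosure B := by
  by_cases hA : A = 0
  · subst hA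
    simp [vClosure, FractionalIdeal.inv_zero']
  · have hB : B ≠ 0 := by
      rintro rfl
      exact hA (le_antisymm h (FractionalIdeal.zero_le _))
    exact FractionalIdeal.inv_anti_mono (inv_ne_zero_of_ne_zero hB) (inv_ne_zero_of_ne_zero hA)
      (FractionalIdeal.inv_anti_mono hA hB h)

/-- The `t`-closure `A_t` of a fractional ideal: the union of the `I_v`, where `I` runs through
the finitely generated fractional ideals contained in `A` (with `0_t = 0`). -/
def tClosure (A : FractionalIdeal R⁰ K) : FractionalIdeal R⁰ K :=
  ⟨{ carrier := {x | ∃ I : FractionalIdeal R⁰ K,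
        (I : Submodule R K).FG ∧ I ≤ A ∧ x ∈ vClosure I}
     zero_mem' := ⟨0, by simpa using Submodule.fg_bot, FractionalIdeal.zero_le _,
       by simp [vClosure, FractionalIdeal.inv_zero']⟩
     add_mem' := by
       rintro x y ⟨I, hI, hIA, hx⟩ ⟨J, hJ, hJA, hy⟩
       refine ⟨I ⊔ J, ?_, sup_le hIA hJA,
         Submodule.add_mem (vClosure (I ⊔ J) : Submodule R K) (vClosure_mono le_sup_left hx)
           (vClosure_mono le_sup_right hy)⟩
       rw [FractionalIdeal.coe_sup]
       exact hI.sup hJ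
     smul_mem' := by
       rintro r x ⟨I, hI, hIA, hx⟩
       exact ⟨I, hI, hIA, Submodule.smul_mem (vClosure I : Submodule R K) r hx⟩ },
   by
     obtain ⟨d, hd, hdA⟩ := (vClosure A).isFractional
     refine ⟨d, hd, ?_⟩
     rintro x ⟨I, _, hIA, hx⟩
     exact hdA x (vClosure_mono hIA hx)⟩

theorem mem_tClosure {A : FractionalIdeal R⁰ K} {x : K} :
    x ∈ tClosure A ↔ ∃ I : FractionalIdeal R⁰ K,
      (I : Submodule R K).FG ∧ I ≤ A ∧ x ∈ vClosure I := Iff.rfl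

end Closures

section Ideals

variable {R : Type*} [CommRing R] [IsDomain R]

/-- An ideal of `R`, seen as a fractional ideal in the quotient field of `R`. -/
abbrev toFrac (I : Ideal R) : FractionalIdeal R⁰ (FractionRing R) := I

/-- `I` is a (nonzero, integral) `t`-ideal. -/
def IsTIdeal (I : Ideal R) : Prop :=
  I ≠ ⊥ ∧ tClosure (toFrac I) = toFrac I

/-- `M` is maximal among the proper `t`-ideals. -/
def IsMaximalTIdeal (M : Ideal R) : Prop :=
  Maximal (fun I : Ideal R => IsTIdeal I ∧ I ≠ ⊤) M

/-- `I` is `t`-invertible: it is nonzero and `(I I⁻¹)_t = R`. -/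
def IsTInvertible (I : Ideal R) : Prop :=
  I ≠ ⊥ ∧ tClosure (toFrac I * (toFrac I)⁻¹) = 1

/-- `I` is a valuation ideal: `I V ∩ R = I` for some valuation overring `V` of `R`, i.e. a
valuation ring `V` of the quotient field of `R` with `R ⊆ V`. Here `I V` is the `V`-submodule
generated by `I`. -/
def IsValuationIdeal (I : Ideal R) : Prop :=
  ∃ V : ValuationSubring (FractionRing R),
    (∀ r : R, algebraMap R (FractionRing R) r ∈ V) ∧
    ∀ r : R, algebraMap R (FractionRing R) r ∈
        Submodule.span V (algebraMap R (FractionRing R) '' (I : Set R)) ↔ r ∈ I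

/-- `a` is a valuation element: a nonzero nonunit such that `aR` is a valuation ideal. -/
def IsValuationElement (a : R) : Prop :=
  a ≠ 0 ∧ ¬ IsUnit a ∧ IsValuationIdeal (Ideal.span {a})

/-- `I = (I₁ ⋯ Iₙ)_t` for some `n ≥ 1` and valuation ideals `I₁, …, Iₙ`. -/
def IsTProductOfValuationIdeals (I : Ideal R) : Prop :=
  ∃ n : ℕ, 0 < n ∧ ∃ J : Fin n → Ideal R,
    (∀ i, IsValuationIdeal (J i)) ∧ tClosure (toFrac (∏ i, J i)) = toFrac I

end Ideals

section Rings

variable (R : Type*) [CommRing R] [IsDomain R]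

/-- `R` is `t`-treed: the prime `t`-ideals form a tree under inclusion, i.e. any two prime
`t`-ideals that lie below a common prime `t`-ideal are comparable. -/
def IsTTreed : Prop :=
  ∀ P Q M : Ideal R, P.IsPrime → Q.IsPrime → M.IsPrime →
    IsTIdeal P → IsTIdeal Q → IsTIdeal M → P ≤ M → Q ≤ M → P ≤ Q ∨ Q ≤ P

/-- `R` is a `t`-valuation ideal factorization domain. -/
def IsTVIFD : Prop :=
  ∀ a : R, a ≠ 0 → IsTProductOfValuationIdeals (Ideal.span {a})

/-- `R` is a valuation factorization domain. -/
def IsVFD : Prop :=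
  ∀ a : R, a ≠ 0 → ¬ IsUnit a →
    ∃ n : ℕ, 0 < n ∧ ∃ f : Fin n → R, (∀ i, IsValuationElement (f i)) ∧ a = ∏ i, f i

/-- `R` is a Prüfer `v`-multiplication domain. -/
def IsPvMD : Prop :=
  ∀ I : Ideal R, I ≠ ⊥ → I.FG → IsTInvertible I

/-- `R` is weakly Matlis (that is, `t`-h-local): it has finite `t`-character, and each nonzero
prime `t`-ideal lies in a unique maximal `t`-ideal. -/
def IsWeaklyMatlis : Prop :=
  (∀ a : R, a ≠ 0 → ¬ IsUnit a → {M : Ideal R | IsMaximalTIdeal M ∧ a ∈ M}.Finite) ∧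
    ∀ P : Ideal R, P.IsPrime → IsTIdeal P → ∃! M : Ideal R, IsMaximalTIdeal M ∧ P ≤ M

/-- `R` is an independent ring of Krull type. -/
def IsIndependentRingOfKrullType : Prop :=
  IsWeaklyMatlis R ∧ IsPvMD R

/-- `R` is a Prüfer domain: each nonzero finitely generated ideal is invertible. -/
def IsPruferDomain : Prop :=
  ∀ I : Ideal R, I ≠ ⊥ → I.FG → toFrac I * (toFrac I)⁻¹ = 1

/-- `R` is h-local: each nonzero nonunit lies in only finitely many maximal ideals, and each
nonzero prime ideal lies in a unique maximal ideal. -/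
def IsHLocal : Prop :=
  (∀ a : R, a ≠ 0 → ¬ IsUnit a → {M : Ideal R | M.IsMaximal ∧ a ∈ M}.Finite) ∧
    ∀ P : Ideal R, P.IsPrime → P ≠ ⊥ → ∃! M : Ideal R, M.IsMaximal ∧ P ≤ M

/-- `R` is a UMT-domain: each upper to zero in `R[X]`, i.e. each nonzero prime ideal of `R[X]`
that contracts to `0` in `R`, is a maximal `t`-ideal of `R[X]`. -/
def IsUMT : Prop :=
  ∀ Q : Ideal R[X], Q.IsPrime → Q ≠ ⊥ → Q.comap (C : R →+* R[X]) = ⊥ → IsMaximalTIdeal Q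

end Rings

section Nagata

variable (R : Type*) [CommRing R] [IsDomain R]

variable {R} in
theorem vClosure_eq_one_iff {I : Ideal R} (hI : I ≠ ⊥) :
    vClosure (toFrac I) = 1 ↔ ∀ r s : R, s ≠ 0 → (∀ b ∈ I, s ∣ r * b) → s ∣ r := by
  have hI' : toFrac I ≠ 0 := FractionalIdeal.coeIdeal_ne_zero.2 hI
  have hinj := IsFractionRing.injective R (FractionRing R)
  have hmem : ∀ r s : R, s ≠ 0 →
      (algebraMap R (FractionRing R) r / algebraMap R (FractionRing R) s ∈
        (1 : FractionalIdeal R⁰ (FractionRing R)) ↔ s ∣ r) := by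
    intro r s hs
    have hs' : algebraMap R (FractionRing R) s ≠ 0 := (map_ne_zero_iff _ hinj).2 hs
    rw [FractionalIdeal.mem_one_iff]
    constructor
    · rintro ⟨c, hc⟩
      rw [eq_div_iff hs', ← map_mul] at hc
      exact ⟨c, by rw [← hinj hc, mul_comm]⟩
    · rintro ⟨c, rfl⟩
      exact ⟨c, by rw [map_mul, mul_div_cancel_left₀ _ hs']⟩
  constructor
  · intro h r s hs hb
    rw [← hmem r s hs]
    have h1 : (1 : FractionRing R) ∈ ((toFrac I)⁻¹)⁻¹ := by
      change (1 : FractionRing R) ∈ vClosure (toFrac I)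
      rw [h]
      exact FractionalIdeal.one_mem_one _
    rw [FractionalIdeal.mem_inv_iff (inv_ne_zero_of_ne_zero hI')] at h1
    have h2 := h1 (algebraMap R (FractionRing R) r / algebraMap R (FractionRing R) s) (by
      rw [FractionalIdeal.mem_inv_iff hI']
      intro y hy
      obtain ⟨b, hbI, rfl⟩ := (FractionalIdeal.mem_coeIdeal _).1 hy
      rw [div_mul_eq_mul_div, ← map_mul, hmem _ _ hs]
      exact hb b hbI)
    rwa [one_mul] at h2
  · intro h
    have hinv : (toFrac I)⁻¹ = 1 := by
      apply le_antisymm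
      · intro x hx
        obtain ⟨r, s, hs, rfl⟩ := IsFractionRing.div_surjective (A := R) x
        have hs := nonZeroDivisors.ne_zero hs
        rw [hmem r s hs]
        refine h r s hs fun b hb => ?_
        rw [← hmem _ _ hs, map_mul, ← div_mul_eq_mul_div]
        exact (FractionalIdeal.mem_inv_iff hI').1 hx _
          ((FractionalIdeal.mem_coeIdeal _).2 ⟨b, hb, rfl⟩)
      · calc (1 : FractionalIdeal R⁰ (FractionRing R)) = 1⁻¹ := by simp
          _ ≤ _ := FractionalIdeal.inv_anti_mono hI' one_ne_zero FractionalIdeal.coeIdeal_le_one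
    simp [vClosure, hinv]

variable {R} in
theorem C_dvd_of_C_dvd_mul {f g : R[X]} (hg : g ≠ 0 ∧ vClosure (toFrac g.contentIdeal) = 1)
    {s : R} (hs : s ≠ 0) (h : C s ∣ f * g) : C s ∣ f := by
  have key := (vClosure_eq_one_iff (by simpa using hg.1)).1 hg.2
  have hker : ∀ p : R[X], p.map (Ideal.Quotient.mk (Ideal.span {s})) = 0 ↔ C s ∣ p := by
    intro p
    rw [C_dvd_iff_dvd_coeff, Polynomial.ext_iff]
    simp [coeff_map, Ideal.Quotient.eq_zero_iff_mem, Ideal.mem_span_singleton]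
  have hnz : g.map (Ideal.Quotient.mk (Ideal.span {s})) ∈ (R ⧸ Ideal.span {s})[X]⁰ := by
    rw [Polynomial.mem_nonZeroDivisors_iff]
    intro a ha
    obtain ⟨r, rfl⟩ := Ideal.Quotient.mk_surjective a
    rw [smul_eq_C_mul, ← map_C, ← Polynomial.map_mul, hker, C_dvd_iff_dvd_coeff] at ha
    rw [Ideal.Quotient.eq_zero_iff_mem, Ideal.mem_span_singleton]
    refine key r s hs fun b hb => ?_
    rw [contentIdeal_def] at hb
    induction hb using Submodule.span_induction with
    | mem x hx =>
      obtain ⟨n, -, rfl⟩ := mem_coeffs_iff.1 hx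
      simpa using ha n
    | zero => simp
    | add x y _ _ hx hy => rw [mul_add]; exact dvd_add hx hy
    | smul c x _ hx => rw [smul_eq_mul, mul_left_comm]; exact hx.mul_left c
  rw [← hker, Polynomial.map_mul] at h
  exact (hker f).1 (mem_nonZeroDivisors_iff_right.1 hnz _ h)

variable {R} in
theorem mul_mem_Nv {f g : R[X]} (hf : f ≠ 0 ∧ vClosure (toFrac f.contentIdeal) = 1)
    (hg : g ≠ 0 ∧ vClosure (toFrac g.contentIdeal) = 1) :
    f * g ≠ 0 ∧ vClosure (toFrac (f * g).contentIdeal) = 1 := by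
  refine ⟨mul_ne_zero hf.1 hg.1, ?_⟩
  rw [vClosure_eq_one_iff (by simpa using mul_ne_zero hf.1 hg.1)]
  intro r s hs hb
  have h1 : C s ∣ C r * f * g := by
    rw [mul_assoc, C_dvd_iff_dvd_coeff]
    intro n
    rw [coeff_C_mul]
    exact hb _ (coeff_mem_contentIdeal _ n)
  have h2 := C_dvd_of_C_dvd_mul hf hs (C_dvd_of_C_dvd_mul hg hs h1)
  simpa using (C_dvd_iff_dvd_coeff _ _).1 h2 0

/-- The multiplicative set `N_v = {f ∈ R[X] | f ≠ 0 and c(f)_v = R}`, where `c(f)` is the ideal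
generated by the coefficients of `f`. -/
def Nv : Submonoid R[X] where
  carrier := {f | f ≠ 0 ∧ vClosure (toFrac f.contentIdeal) = 1}
  one_mem' := ⟨one_ne_zero, by simp [vClosure, toFrac]⟩
  mul_mem' := mul_mem_Nv

theorem Nv_le_nonZeroDivisors : Nv R ≤ R[X]⁰ :=
  fun _ hf => mem_nonZeroDivisors_of_ne_zero hf.1

/-- The ring `R[X]_{N_v}`. -/
abbrev NvLocalization : Type _ := Localization (Nv R)

instance : IsDomain (NvLocalization R) :=
  IsLocalization.isDomain_localization (Nv_le_nonZeroDivisors R)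

end Nagata

end

end TIdeals

open TIdeals

set_option linter.unusedSectionVars false

/-! The proof runs through three cycles meeting in (3): 1 → 2 → 8 → 3 → 1, 3 → 4 → 5 → 3 and 3 → 7 →
6 → 3. Everything is tested at maximal `t`-ideals `M`. An element lying locally in `A` at every `M`
lies in `A_t` (`mem_tcl_of_forall_isMaximalTIdeal`), and `D` is a P`v`MD exactly when every `D_M` is
a valuation ring (`isPvMD_iff`).

3 → 1: a proper `t`-ideal `I` lies in finitely many `M`. The contractions `I D_M ∩ D` are valuation
ideals, and by independence each lies in no maximal `t`-ideal but its own `M`, so the `t`-closure of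
their product is `I`. 2 → 8: the factors of a principal ideal are `t`-invertible, and a prime
containing the ideal contains a factor.

8 → 3 is the core and is where treedness enters. The primes inside `M` form a chain, so every
nonzero `b` in `M` divides, locally, a power of a local generator of a `t`-invertible valuation
ideal. Hence `b` itself generates a valuation ideal of `D_M`, and any two elements become comparable
(`isPvMD_of_isTTreed`). In a P`v`MD a `t`-invertible valuation ideal lies in at most one maximal
`t`-ideal. This gives independence, and an Oka family argument gives finite character.

For `D[X]`, a maximal `t`-ideal is either an upper to zero, where the localization comes from the
PID `K[X]`, or `M[X]` with `M` a maximal `t`-ideal of `D`, where Gauss's lemma applies. The nonzero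
maximal ideals of `D[X]_{N_v}` are the extensions of the `M`, and they are `t`-ideals. There
"independent ring of Krull type" means "h-local Prüfer". The UMT property carries treedness to
`D[X]` and `D[X]_{N_v}`, so 8 → 3 applies in these rings, and the conclusion descends to `D`. -/

namespace TIdeals

/-! ### Translation of the fractional-ideal notions into divisibility in `R`. -/

section DivisibilityClosures

variable {R : Type*} [CommRing R] [IsDomain R]

/-- The divisorial closure of a nonzero ideal, described through divisibility: `r / s` runs
through the inverse of `I`. -/
def vcl (I : Ideal R) : Ideal R where
  carrier := {x | ∀ r s : R, s ≠ 0 → (∀ b ∈ I, s ∣ r * b) → s ∣ r * x}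
  zero_mem' := by simp
  add_mem' := by
    intro x y hx hy r s hs h
    rw [mul_add]
    exact dvd_add (hx r s hs h) (hy r s hs h)
  smul_mem' := by
    intro c x hx r s hs h
    rw [smul_eq_mul, mul_left_comm]
    exact (hx r s hs h).mul_left c

theorem mem_vcl {I : Ideal R} {x : R} :
    x ∈ vcl I ↔ ∀ r s : R, s ≠ 0 → (∀ b ∈ I, s ∣ r * b) → s ∣ r * x := Iff.rfl

theorem vcl_mono {I J : Ideal R} (h : I ≤ J) : vcl I ≤ vcl J :=
  fun _ hx r s hs hb => hx r s hs fun b hbI => hb b (h hbI)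

theorem le_vcl (I : Ideal R) : I ≤ vcl I := fun _ hx _ _ _ hb => hb _ hx

theorem vcl_vcl (I : Ideal R) : vcl (vcl I) ≤ vcl I :=
  fun _ hx r s hs hb => hx r s hs fun _ hy => hy r s hs hb

theorem vcl_span_singleton {a : R} (ha : a ≠ 0) : vcl (Ideal.span {a}) ≤ Ideal.span {a} := by
  intro x hx
  rw [Ideal.mem_span_singleton]
  have := hx 1 a ha fun b hb => by simpa using Ideal.mem_span_singleton.1 hb
  simpa using this

theorem mul_mem_vcl_mul {I J : Ideal R} {x y : R} (hx : x ∈ vcl I) (hy : y ∈ vcl J) :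
    x * y ∈ vcl (I * J) := by
  intro r s hs h
  rw [mul_left_comm, mul_comm x]
  refine hx (r * y) s hs fun b hb => ?_
  rw [mul_right_comm]
  refine hy (r * b) s hs fun c hc => ?_
  rw [mul_assoc]
  exact h _ (Ideal.mul_mem_mul hb hc)

/-- The `t`-closure of a nonzero ideal, as an ideal. -/
def tcl (I : Ideal R) : Ideal R where
  carrier := {x | ∃ F : Ideal R, F.FG ∧ F ≤ I ∧ x ∈ vcl F}
  zero_mem' := ⟨⊥, Submodule.fg_bot, bot_le, zero_mem _⟩
  add_mem' := by
    rintro x y ⟨F, hF, hFI, hx⟩ ⟨G, hG, hGI, hy⟩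
    exact ⟨F ⊔ G, Submodule.FG.sup hF hG, sup_le hFI hGI,
      add_mem (vcl_mono le_sup_left hx) (vcl_mono le_sup_right hy)⟩
  smul_mem' := by
    rintro c x ⟨F, hF, hFI, hx⟩
    exact ⟨F, hF, hFI, Ideal.mul_mem_left _ c hx⟩

/-- The ideal `I I⁻¹`, described through divisibility. -/
def traceIdeal (I : Ideal R) : Ideal R :=
  Ideal.span {x | ∃ a ∈ I, a ≠ 0 ∧ ∀ b ∈ I, a ∣ x * b}

local notation "ι" => algebraMap R (FractionRing R)

theorem div_mem_one_iff {r s : R} (hs : s ≠ 0) :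
    ι r / ι s ∈ (1 : FractionalIdeal R⁰ (FractionRing R)) ↔ s ∣ r := by
  have hinj := IsFractionRing.injective R (FractionRing R)
  have hs' : ι s ≠ 0 := (map_ne_zero_iff _ hinj).2 hs
  rw [FractionalIdeal.mem_one_iff]
  constructor
  · rintro ⟨c, hc⟩
    rw [eq_div_iff hs', ← map_mul] at hc
    exact ⟨c, by rw [← hinj hc, mul_comm]⟩
  · rintro ⟨c, rfl⟩
    exact ⟨c, by rw [map_mul, mul_div_cancel_left₀ _ hs']⟩

theorem div_mem_inv_iff {I : Ideal R} (hI : I ≠ ⊥) {r s : R} (hs : s ≠ 0) :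
    ι r / ι s ∈ (toFrac I)⁻¹ ↔ ∀ b ∈ I, s ∣ r * b := by
  rw [FractionalIdeal.mem_inv_iff (FractionalIdeal.coeIdeal_ne_zero.2 hI)]
  constructor
  · intro h b hb
    rw [← div_mem_one_iff hs, map_mul, ← div_mul_eq_mul_div]
    exact h _ ((FractionalIdeal.mem_coeIdeal _).2 ⟨b, hb, rfl⟩)
  · intro h y hy
    obtain ⟨b, hb, rfl⟩ := (FractionalIdeal.mem_coeIdeal _).1 hy
    rw [div_mul_eq_mul_div, ← map_mul, div_mem_one_iff hs]
    exact h b hb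

theorem vClosure_toFrac {I : Ideal R} (hI : I ≠ ⊥) : vClosure (toFrac I) = toFrac (vcl I) := by
  have hI' : toFrac I ≠ 0 := FractionalIdeal.coeIdeal_ne_zero.2 hI
  have hle : vClosure (toFrac I) ≤ 1 := by
    refine (vClosure_mono (FractionalIdeal.coeIdeal_le_one)).trans ?_
    simp [vClosure]
  have key : ∀ x : R, ι x ∈ vClosure (toFrac I) ↔ x ∈ vcl I := by
    intro x
    rw [vClosure, FractionalIdeal.mem_inv_iff (inv_ne_zero_of_ne_zero hI'), mem_vcl]
    constructor
    · intro h r s hs hb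
      have := h _ ((div_mem_inv_iff hI hs).2 hb)
      rwa [mul_comm, div_mul_eq_mul_div, ← map_mul, div_mem_one_iff hs] at this
    · intro h u hu
      obtain ⟨r, s, hs, rfl⟩ := IsFractionRing.div_surjective (A := R) u
      have hs := nonZeroDivisors.ne_zero hs
      rw [mul_comm, div_mul_eq_mul_div, ← map_mul, div_mem_one_iff hs]
      exact h r s hs ((div_mem_inv_iff hI hs).1 hu)
  ext x
  constructor
  · intro hx
    obtain ⟨y, rfl⟩ := FractionalIdeal.mem_one_iff _ |>.1 (hle hx)
    exact (FractionalIdeal.mem_coeIdeal _).2 ⟨y, (key y).1 hx, rfl⟩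
  · intro hx
    obtain ⟨y, hy, rfl⟩ := (FractionalIdeal.mem_coeIdeal _).1 hx
    exact (key y).2 hy

theorem vClosure_zero : vClosure (0 : FractionalIdeal R⁰ (FractionRing R)) = 0 := by
  simp [vClosure, FractionalIdeal.inv_zero']

theorem tClosure_zero : tClosure (0 : FractionalIdeal R⁰ (FractionRing R)) = 0 := by
  ext x
  rw [mem_tClosure]
  constructor
  · rintro ⟨A, -, hA, hx⟩
    rwa [le_antisymm hA (FractionalIdeal.zero_le _), vClosure_zero] at hx
  · intro hx
    exact ⟨0, by simpa using Submodule.fg_bot, le_rfl, by rwa [vClosure_zero]⟩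

theorem tClosure_toFrac {I : Ideal R} (hI : I ≠ ⊥) : tClosure (toFrac I) = toFrac (tcl I) := by
  have hinj := IsFractionRing.injective R (FractionRing R)
  ext x
  rw [mem_tClosure, FractionalIdeal.mem_coeIdeal]
  constructor
  · rintro ⟨A, hA, hAI, hx⟩
    obtain ⟨F, rfl⟩ := FractionalIdeal.le_one_iff_exists_coeIdeal.1
      (hAI.trans FractionalIdeal.coeIdeal_le_one)
    rw [FractionalIdeal.coeIdeal_fg _ hinj] at hA
    have hFI : F ≤ I := (FractionalIdeal.coeIdeal_le_coeIdeal _).1 hAI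
    by_cases hF : F = ⊥
    · subst hF
      rw [FractionalIdeal.coeIdeal_bot, vClosure_zero, FractionalIdeal.mem_zero_iff] at hx
      exact ⟨0, zero_mem _, by simp [hx]⟩
    · change x ∈ vClosure (toFrac F) at hx
      rw [vClosure_toFrac hF, FractionalIdeal.mem_coeIdeal] at hx
      obtain ⟨y, hy, rfl⟩ := hx
      exact ⟨y, ⟨F, hA, hFI, hy⟩, rfl⟩
  · rintro ⟨y, ⟨F, hF, hFI, hy⟩, rfl⟩
    -- `F` may be zero, where `vcl` and `vClosure` can differ; a nonzero element of `I` is added to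
    -- avoid this case.
    obtain ⟨b, hbI, hb⟩ := Submodule.exists_mem_ne_zero_of_ne_bot hI
    have hG : F ⊔ Ideal.span {b} ≠ ⊥ := by
      intro h
      exact hb (by simpa using (sup_eq_bot_iff.1 h).2)
    refine ⟨toFrac (F ⊔ Ideal.span {b}), ?_, ?_, ?_⟩
    · rw [FractionalIdeal.coeIdeal_fg _ hinj]
      exact Submodule.FG.sup hF (Submodule.fg_span_singleton b)
    · rw [FractionalIdeal.coeIdeal_le_coeIdeal]
      exact sup_le hFI ((Ideal.span_singleton_le_iff_mem _).2 hbI)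
    · rw [vClosure_toFrac hG, FractionalIdeal.mem_coeIdeal]
      exact ⟨y, vcl_mono le_sup_left hy, rfl⟩

theorem le_tcl (I : Ideal R) : I ≤ tcl I := fun x hx =>
  ⟨Ideal.span {x}, Submodule.fg_span_singleton x, (Ideal.span_singleton_le_iff_mem _).2 hx,
    le_vcl _ (Ideal.mem_span_singleton_self x)⟩

theorem isTIdeal_iff {I : Ideal R} : IsTIdeal I ↔ I ≠ ⊥ ∧ tcl I ≤ I := by
  refine and_congr_right fun hI => ?_
  rw [tClosure_toFrac hI, FractionalIdeal.coeIdeal_inj]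
  exact ⟨fun h => h.le, fun h => le_antisymm h (le_tcl I)⟩

theorem toFrac_mul_inv {I : Ideal R} (hI : I ≠ ⊥) :
    toFrac I * (toFrac I)⁻¹ = toFrac (traceIdeal I) := by
  have hinj := IsFractionRing.injective R (FractionRing R)
  have hI' : toFrac I ≠ 0 := FractionalIdeal.coeIdeal_ne_zero.2 hI
  apply le_antisymm
  · rw [FractionalIdeal.mul_le]
    intro y hy u hu
    obtain ⟨a, ha, rfl⟩ := (FractionalIdeal.mem_coeIdeal _).1 hy
    obtain ⟨c, hc⟩ := FractionalIdeal.mem_one_iff _ |>.1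
      ((FractionalIdeal.mem_inv_iff hI').1 hu _ hy)
    rw [mul_comm, ← hc, FractionalIdeal.mem_coeIdeal]
    refine ⟨c, ?_, rfl⟩
    by_cases ha0 : a = 0
    · rw [ha0, map_zero, mul_zero, map_eq_zero_iff _ hinj] at hc
      rw [hc]
      exact zero_mem _
    · refine Ideal.subset_span ⟨a, ha, ha0, fun b hb => ?_⟩
      obtain ⟨d, hd⟩ := FractionalIdeal.mem_one_iff _ |>.1
        ((FractionalIdeal.mem_inv_iff hI').1 hu _
          ((FractionalIdeal.mem_coeIdeal _).2 ⟨b, hb, rfl⟩))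
      refine ⟨d, hinj ?_⟩
      rw [map_mul, map_mul, hc, hd]
      ring
  · intro x hx
    obtain ⟨y, hy, rfl⟩ := (FractionalIdeal.mem_coeIdeal _).1 hx
    clear hx
    induction hy using Submodule.span_induction with
    | mem y hy =>
      obtain ⟨a, haI, ha, hab⟩ := hy
      have ha' : ι a ≠ 0 := (map_ne_zero_iff _ hinj).2 ha
      have : ι y = ι a * (ι y / ι a) := by field_simp
      rw [this]
      exact FractionalIdeal.mul_mem_mul ((FractionalIdeal.mem_coeIdeal _).2 ⟨a, haI, rfl⟩)
        ((div_mem_inv_iff hI ha).2 hab)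
    | zero => rw [map_zero]; exact Submodule.zero_mem _
    | add y z _ _ hy hz => rw [map_add]; exact Submodule.add_mem _ hy hz
    | smul c y _ hy =>
      rw [smul_eq_mul, map_mul, ← Algebra.smul_def]
      exact Submodule.smul_mem _ c hy

theorem traceIdeal_ne_bot {I : Ideal R} (hI : I ≠ ⊥) : traceIdeal I ≠ ⊥ := by
  obtain ⟨b, hbI, hb⟩ := Submodule.exists_mem_ne_zero_of_ne_bot hI
  intro h
  have : b ∈ traceIdeal I := Ideal.subset_span ⟨b, hbI, hb, fun c _ => dvd_mul_right b c⟩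
  rw [h] at this
  exact hb this

theorem isTInvertible_iff {I : Ideal R} : IsTInvertible I ↔ I ≠ ⊥ ∧ tcl (traceIdeal I) = ⊤ := by
  refine and_congr_right fun hI => ?_
  rw [toFrac_mul_inv hI, tClosure_toFrac (traceIdeal_ne_bot hI), FractionalIdeal.coeIdeal_eq_one,
    Ideal.one_eq_top]

theorem isPruferDomain_iff :
    IsPruferDomain R ↔ ∀ I : Ideal R, I ≠ ⊥ → I.FG → traceIdeal I = ⊤ := by
  refine forall_congr' fun I => forall_congr' fun hI => forall_congr' fun _ => ?_
  rw [toFrac_mul_inv hI, FractionalIdeal.coeIdeal_eq_one, Ideal.one_eq_top]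

theorem isTProductOfValuationIdeals_iff {I : Ideal R} (hI : I ≠ ⊥) :
    IsTProductOfValuationIdeals I ↔ ∃ n : ℕ, 0 < n ∧ ∃ J : Fin n → Ideal R,
      (∀ i, IsValuationIdeal (J i)) ∧ ∏ i, J i ≠ ⊥ ∧ tcl (∏ i, J i) = I := by
  refine exists_congr fun n => and_congr_right fun _ => exists_congr fun J =>
    and_congr_right fun _ => ?_
  by_cases hJ : ∏ i, J i = ⊥
  · simp only [hJ, ne_eq, not_true_eq_false, false_and, iff_false]
    rw [toFrac, FractionalIdeal.coeIdeal_bot, tClosure_zero]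
    exact fun h => FractionalIdeal.coeIdeal_ne_zero.2 hI h.symm
  · rw [tClosure_toFrac hJ, FractionalIdeal.coeIdeal_inj]
    simp [hJ]

/-- Values are totally ordered, so each element of `I V` is a `V`-multiple of a single element of
`I`. The valuation is multiplicative: a smaller value means more divisible. -/
theorem isValuationIdeal_iff {I : Ideal R} :
    IsValuationIdeal I ↔ ∃ V : ValuationSubring (FractionRing R), (∀ r : R, ι r ∈ V) ∧
      ∀ r : R, ∀ a ∈ I, V.valuation (ι r) ≤ V.valuation (ι a) → r ∈ I := by
  refine exists_congr fun V => and_congr_right fun _ => ?_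
  constructor
  · intro h r a ha hra
    rw [← h]
    obtain ⟨c, hc⟩ := (V.valuation_le_iff _ _).1 hra
    rw [← hc]
    exact Submodule.smul_mem _ c (Submodule.subset_span ⟨a, ha, rfl⟩)
  · intro h r
    refine ⟨fun hr => ?_, fun hr => Submodule.subset_span ⟨r, hr, rfl⟩⟩
    have : ∀ x ∈ Submodule.span V (ι '' (I : Set R)), ∃ a ∈ I,
        V.valuation x ≤ V.valuation (ι a) := by
      intro x hx
      induction hx using Submodule.span_induction with
      | mem x hx =>
        obtain ⟨a, ha, rfl⟩ := hx
        exact ⟨a, ha, le_rfl⟩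
      | zero => exact ⟨0, zero_mem _, by simp⟩
      | add x y _ _ hx hy =>
        obtain ⟨a, ha, hxa⟩ := hx
        obtain ⟨b, hb, hyb⟩ := hy
        rcases le_total (V.valuation (ι a)) (V.valuation (ι b)) with hab | hab
        · exact ⟨b, hb, V.valuation.map_add_le (hxa.trans hab) hyb⟩
        · exact ⟨a, ha, V.valuation.map_add_le hxa (hyb.trans hab)⟩
      | smul c x _ hx =>
        obtain ⟨a, ha, hxa⟩ := hx
        refine ⟨a, ha, ?_⟩
        rw [Algebra.smul_def, map_mul]
        exact (mul_le_of_le_one_left' (V.valuation_le_one c)).trans hxa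
    obtain ⟨a, ha, hra⟩ := this _ hr
    exact h r a ha hra

end DivisibilityClosures

end TIdeals

namespace TIdeals

/-! ### General theory of `t`-ideals. -/

section TIdealTheory

variable {R : Type*} [CommRing R] [IsDomain R]

theorem tcl_mono {I J : Ideal R} (h : I ≤ J) : tcl I ≤ tcl J :=
  fun _ ⟨F, hF, hFI, hx⟩ => ⟨F, hF, hFI.trans h, hx⟩

/-- A finitely generated ideal contained in the `t`-closure of `I` is contained in the
divisorial closure of a single finitely generated ideal contained in `I`. -/
theorem exists_fg_le_of_fg_le_tcl {I F : Ideal R} (hF : F.FG) (h : F ≤ tcl I) :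
    ∃ G : Ideal R, G.FG ∧ G ≤ I ∧ F ≤ vcl G := by
  induction F, hF using Submodule.fg_induction with
  | singleton x =>
    obtain ⟨G, hG, hGI, hx⟩ := h (Submodule.mem_span_singleton_self x)
    exact ⟨G, hG, hGI, (Submodule.span_singleton_le_iff_mem _ _).2 hx⟩
  | sup F₁ F₂ _ _ h₁ h₂ =>
    obtain ⟨G₁, hG₁, hGI₁, hx₁⟩ := h₁ (le_sup_left.trans h)
    obtain ⟨G₂, hG₂, hGI₂, hx₂⟩ := h₂ (le_sup_right.trans h)
    exact ⟨G₁ ⊔ G₂, Submodule.FG.sup hG₁ hG₂, sup_le hGI₁ hGI₂,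
      sup_le (hx₁.trans (vcl_mono le_sup_left)) (hx₂.trans (vcl_mono le_sup_right))⟩

theorem tcl_tcl (I : Ideal R) : tcl (tcl I) ≤ tcl I := by
  rintro x ⟨F, hF, hFI, hx⟩
  obtain ⟨G, hG, hGI, hFG⟩ := exists_fg_le_of_fg_le_tcl hF hFI
  exact ⟨G, hG, hGI, vcl_vcl _ (vcl_mono hFG hx)⟩

theorem mul_mem_tcl_mul {I J : Ideal R} {x y : R} (hx : x ∈ tcl I) (hy : y ∈ tcl J) :
    x * y ∈ tcl (I * J) := by
  obtain ⟨F, hF, hFI, hx⟩ := hx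
  obtain ⟨G, hG, hGI, hy⟩ := hy
  exact ⟨F * G, Submodule.FG.mul hF hG, Ideal.mul_mono hFI hGI, mul_mem_vcl_mul hx hy⟩

theorem mem_vcl_of_one_mem_vcl {F A : Ideal R} (h1 : (1 : R) ∈ vcl F) {x : R}
    (hx : ∀ b ∈ F, b * x ∈ A) : x ∈ vcl A := by
  intro r s hs h
  have := h1 (r * x) s hs fun b hb => by
    rw [mul_assoc, mul_comm x]
    exact h _ (hx b hb)
  simpa using this

theorem mem_tcl_of_one_mem_tcl {I A : Ideal R} (h1 : (1 : R) ∈ tcl I) {x : R}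
    (hx : ∀ b ∈ I, b * x ∈ A) : x ∈ tcl A := by
  obtain ⟨F, hF, hFI, h1⟩ := h1
  refine ⟨F * Ideal.span {x}, Submodule.FG.mul hF (Submodule.fg_span_singleton x), ?_,
    mem_vcl_of_one_mem_vcl h1 fun b hb => Ideal.mul_mem_mul hb (Ideal.mem_span_singleton_self x)⟩
  rw [Ideal.mul_le]
  intro b hb y hy
  obtain ⟨c, rfl⟩ := Ideal.mem_span_singleton.1 hy
  have := Ideal.mul_mem_right c _ (hx b (hFI hb))
  rwa [mul_assoc] at this

theorem isTIdeal_span_singleton {a : R} (ha : a ≠ 0) : IsTIdeal (Ideal.span {a}) := by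
  rw [isTIdeal_iff]
  refine ⟨by simpa using ha, ?_⟩
  rintro x ⟨F, -, hF, hx⟩
  exact vcl_span_singleton ha (vcl_mono hF hx)

theorem IsTIdeal.ne_bot {I : Ideal R} (h : IsTIdeal I) : I ≠ ⊥ := h.1

theorem IsTIdeal.tcl_le {I : Ideal R} (h : IsTIdeal I) : tcl I ≤ I := (isTIdeal_iff.1 h).2

theorem isTIdeal_tcl {I : Ideal R} (h : I ≠ ⊥) : IsTIdeal (tcl I) :=
  isTIdeal_iff.2 ⟨fun h' => h (le_bot_iff.1 (h' ▸ le_tcl I)), tcl_tcl I⟩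

/-- Zorn's lemma applies because the `t`-closure has finite type: a finitely generated ideal inside
the union of a chain lies in one member. -/
theorem exists_isMaximalTIdeal {I : Ideal R} (hI : IsTIdeal I) (hI' : I ≠ ⊤) :
    ∃ M, IsMaximalTIdeal M ∧ I ≤ M := by
  have hzorn := zorn_le_nonempty₀ {J : Ideal R | IsTIdeal J ∧ J ≠ ⊤} ?_ I ⟨hI, hI'⟩
  · obtain ⟨M, hIM, hM⟩ := hzorn
    exact ⟨M, hM, hIM⟩
  · intro c hc hchain J hJ
    have hdir : DirectedOn (· ≤ ·) c := hchain.directedOn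
    refine ⟨sSup c, ⟨isTIdeal_iff.2 ⟨fun h => ?_, ?_⟩, ?_⟩, fun z hz => le_sSup hz⟩
    · exact (hc hJ).1.ne_bot (le_bot_iff.1 (h ▸ le_sSup hJ))
    · rintro x ⟨F, hF, hFI, hx⟩
      have hFc := (Submodule.fg_iff_compact F).1 hF
      obtain ⟨L, hL, hFL⟩ := (CompleteLattice.isCompactElement_iff_le_of_directed_sSup_le _ F).1
        hFc c ⟨J, hJ⟩ hdir hFI
      exact le_sSup hL ((hc hL).1.tcl_le ⟨F, hF, hFL, hx⟩)
    · rw [Ne, Ideal.eq_top_iff_one, Submodule.mem_sSup_of_directed ⟨J, hJ⟩ hdir]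
      rintro ⟨L, hL, h1⟩
      exact (hc hL).2 ((Ideal.eq_top_iff_one _).2 h1)

theorem IsMaximalTIdeal.isTIdeal {M : Ideal R} (h : IsMaximalTIdeal M) : IsTIdeal M := h.prop.1

theorem IsMaximalTIdeal.ne_top {M : Ideal R} (h : IsMaximalTIdeal M) : M ≠ ⊤ := h.prop.2

theorem IsMaximalTIdeal.eq_of_le {M N : Ideal R} (hM : IsMaximalTIdeal M) (hN : IsTIdeal N)
    (hN' : N ≠ ⊤) (h : M ≤ N) : M = N := Maximal.eq_of_le hM ⟨hN, hN'⟩ h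

theorem exists_isMaximalTIdeal_of_tcl_ne_top {I : Ideal R} (hI : I ≠ ⊥) (hI' : tcl I ≠ ⊤) :
    ∃ M, IsMaximalTIdeal M ∧ I ≤ M := by
  obtain ⟨M, hM, h⟩ := exists_isMaximalTIdeal (isTIdeal_tcl hI) hI'
  exact ⟨M, hM, (le_tcl I).trans h⟩

theorem IsMaximalTIdeal.one_mem_tcl_sup {M : Ideal R} (hM : IsMaximalTIdeal M) {x : R}
    (hx : x ∉ M) : (1 : R) ∈ tcl (M ⊔ Ideal.span {x}) := by
  by_contra h
  have hle : M ≤ M ⊔ Ideal.span {x} := le_sup_left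
  have := hM.eq_of_le (isTIdeal_tcl fun h' => hM.isTIdeal.ne_bot (le_bot_iff.1 (h' ▸ hle)))
    (fun h' => h (h' ▸ Submodule.mem_top)) (hle.trans (le_tcl _))
  exact hx (this ▸ le_tcl _ (Ideal.mem_sup_right (Ideal.mem_span_singleton_self x)))

/-- If `x` and `y` are outside `M`, then `1` is in the `t`-closures of `M + (x)` and `M + (y)`,
hence in that of their product, which lies in `M` when `xy` does. -/
theorem IsMaximalTIdeal.isPrime {M : Ideal R} (hM : IsMaximalTIdeal M) : M.IsPrime := by
  refine ⟨hM.ne_top, ?_⟩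
  intro x y hxy
  by_contra! h
  refine hM.ne_top ((Ideal.eq_top_iff_one _).2 (hM.isTIdeal.tcl_le ?_))
  have := mul_mem_tcl_mul (hM.one_mem_tcl_sup h.1) (hM.one_mem_tcl_sup h.2)
  rw [one_mul] at this
  refine tcl_mono ?_ this
  rw [Ideal.sup_mul, Ideal.mul_sup, Ideal.mul_sup, Ideal.span_singleton_mul_span_singleton]
  exact sup_le (sup_le Ideal.mul_le_left Ideal.mul_le_left)
    (sup_le Ideal.mul_le_right ((Ideal.span_singleton_le_iff_mem _).2 hxy))

/-- The local-global principle. The colon ideal `(A : x)` lies in no maximal `t`-ideal, so its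
`t`-closure is the whole ring. -/
theorem mem_tcl_of_forall_isMaximalTIdeal {A : Ideal R} (hA : A ≠ ⊥) {x : R}
    (h : ∀ M : Ideal R, IsMaximalTIdeal M → ∃ s, s ∉ M ∧ s * x ∈ A) : x ∈ tcl A := by
  let B : Ideal R := A.colon (Ideal.span {x})
  have hB : ∀ b, b ∈ B ↔ b * x ∈ A := fun b => Ideal.mem_colon_span_singleton
  have hAB : A ≤ B := fun a ha => (hB a).2 (Ideal.mul_mem_right _ _ ha)
  by_cases h1 : tcl B = ⊤
  · exact mem_tcl_of_one_mem_tcl (I := B) (h1 ▸ Submodule.mem_top) fun b hb => (hB b).1 hb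
  · obtain ⟨M, hM, hBM⟩ := exists_isMaximalTIdeal_of_tcl_ne_top
      (fun h' => hA (le_bot_iff.1 (h' ▸ hAB))) h1
    obtain ⟨s, hs, hsx⟩ := h M hM
    exact absurd (hBM ((hB s).2 hsx)) hs

/-- In the localization at `P`, `c` lies in every prime over `b`, hence in the radical of `(b)`. The
multiplicative set is generated by the complement of `P` and the powers of `c`. -/
theorem exists_dvd_mul_pow {P : Ideal R} [P.IsPrime] {b c : R}
    (h : ∀ Q : Ideal R, Q.IsPrime → Q ≤ P → b ∈ Q → c ∈ Q) :
    ∃ s, s ∉ P ∧ ∃ n : ℕ, b ∣ s * c ^ n := by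
  by_contra! hcon
  have hdisj : Disjoint (Ideal.span {b} : Set R)
      ((P.primeCompl ⊔ Submonoid.powers c : Submonoid R) : Set R) := by
    rw [Set.disjoint_left]
    rintro x hx hx'
    obtain ⟨s, hs, y, ⟨n, rfl⟩, rfl⟩ := Submonoid.mem_sup.1 hx'
    exact hcon s hs n (Ideal.mem_span_singleton.1 hx)
  obtain ⟨Q, hQ, hbQ, hd⟩ := Ideal.exists_le_prime_disjoint _ _ hdisj
  rw [Set.disjoint_left] at hd
  refine hd (h Q hQ (fun x hx => ?_) (hbQ (Ideal.mem_span_singleton_self b)))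
    (Submonoid.mem_sup_right (Submonoid.mem_powers c))
  by_contra hxP
  exact hd hx (Submonoid.mem_sup_left (show x ∈ P.primeCompl from hxP))

/-- Locally at `P` the radical of `(a)` is `P`, so a finitely generated `F ≤ P` satisfies `s F^n ⊆
(a)` with `s ∉ P`. As `(a)` is divisorial, the same `s` and `n` serve for elements of `F_v`. -/
theorem isTIdeal_of_mem_minimalPrimes {a : R} (ha : a ≠ 0) {P : Ideal R}
    (hP : P ∈ (Ideal.span {a}).minimalPrimes) : IsTIdeal P := by
  have hPp : P.IsPrime := hP.1.1
  have haP : a ∈ P := hP.1.2 (Ideal.mem_span_singleton_self a)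
  rw [isTIdeal_iff]
  refine ⟨fun h => ha (by simpa [h] using haP), ?_⟩
  rintro x ⟨F, hF, hFP, hx⟩
  have key : ∃ s, s ∉ P ∧ ∃ n : ℕ, ∀ y ∈ F ^ n, a ∣ s * y := by
    clear hx
    induction F, hF using Submodule.fg_induction with
    | singleton f =>
      obtain ⟨s, hs, n, hn⟩ := exists_dvd_mul_pow (P := P) (b := a) (c := f)
        fun Q hQ hQP haQ => hP.2 ⟨hQ, (Ideal.span_singleton_le_iff_mem _).2 haQ⟩ hQP
          (hFP (Submodule.mem_span_singleton_self f))
      refine ⟨s, hs, n, fun y hy => ?_⟩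
      rw [Ideal.submodule_span_eq, Ideal.span_singleton_pow, Ideal.mem_span_singleton] at hy
      exact hn.trans (mul_dvd_mul_left s hy)
    | sup F₁ F₂ _ _ h₁ h₂ =>
      obtain ⟨s, hs, n, hn⟩ := h₁ (le_sup_left.trans hFP)
      obtain ⟨t, ht, m, hm⟩ := h₂ (le_sup_right.trans hFP)
      refine ⟨s * t, hPp.mul_notMem hs ht, n + m, fun y hy => ?_⟩
      obtain ⟨y₁, hy₁, y₂, hy₂, rfl⟩ := Submodule.mem_sup.1 (Ideal.sup_pow_add_le_pow_sup_pow hy)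
      rw [mul_add]
      refine dvd_add ?_ ?_
      · rw [mul_right_comm]
        exact (hn y₁ hy₁).mul_right t
      · rw [mul_assoc]
        exact (hm y₂ hy₂).mul_left s
  obtain ⟨s, hs, n, hn⟩ := key
  have hxn : x ^ n ∈ vcl (F ^ n) := by
    clear hn
    induction n with
    | zero => simpa using le_vcl _ Submodule.mem_top
    | succ n ih => rw [pow_succ, pow_succ]; exact mul_mem_vcl_mul ih hx
  have := hxn s a ha hn
  have hmem : s * x ^ n ∈ P := P.mem_of_dvd this haP
  exact hPp.mem_of_pow_mem n ((hPp.mem_or_mem hmem).resolve_left hs)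

end TIdealTheory

end TIdeals

namespace TIdeals

/-! ### Local criteria for `t`-invertibility and for P`v`MDs. -/

section LocalDivisibility

variable {R : Type*} [CommRing R] [IsDomain R]

/-- `b` divides `c` in the localization at the prime ideal `M`. -/
def DvdAt (M : Ideal R) (b c : R) : Prop := ∃ s, s ∉ M ∧ b ∣ s * c

/-- The localization at the prime ideal `M` is a valuation ring. -/
def IsValuationAt (M : Ideal R) : Prop := ∀ b c : R, DvdAt M b c ∨ DvdAt M c b

theorem IsValuationAt.exists_generator {M : Ideal R} [M.IsPrime] (hM : IsValuationAt M)
    {F : Ideal R} (hF : F.FG) (hF0 : F ≠ ⊥) :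
    ∃ a ∈ F, a ≠ 0 ∧ ∃ s, s ∉ M ∧ ∀ b ∈ F, a ∣ s * b := by
  have key : ∃ a ∈ F, ∃ s, s ∉ M ∧ ∀ b ∈ F, a ∣ s * b := by
    clear hF0
    induction F, hF using Submodule.fg_induction with
    | singleton x =>
      exact ⟨x, Submodule.mem_span_singleton_self x, 1, M.one_notMem, fun b hb => by
        rw [one_mul]
        exact Ideal.mem_span_singleton.1 hb⟩
    | sup F₁ F₂ _ _ h₁ h₂ =>
      obtain ⟨a, ha, s, hs, hsa⟩ := h₁
      obtain ⟨b, hb, t, ht, htb⟩ := h₂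
      have aux : ∀ {F₁ F₂ : Ideal R} {a b s t : R}, s ∉ M → t ∉ M → (∀ c ∈ F₁, a ∣ s * c) →
          (∀ c ∈ F₂, b ∣ t * c) → DvdAt M a b → ∃ u, u ∉ M ∧ ∀ c ∈ F₁ ⊔ F₂, a ∣ u * c := by
        intro F₁ F₂ a b s t hs ht hsa htb ⟨u, hu, huab⟩
        refine ⟨u * s * t, Ideal.IsPrime.mul_notMem ‹_› (Ideal.IsPrime.mul_notMem ‹_› hu hs) ht,
          fun c hc => ?_⟩
        obtain ⟨x, hx, y, hy, rfl⟩ := Submodule.mem_sup.1 hc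
        rw [mul_add]
        refine dvd_add ?_ ?_
        · exact ((hsa x hx).mul_left (u * t)).trans (dvd_of_eq (by ring))
        · obtain ⟨d, hd⟩ := htb y hy
          exact (huab.mul_right (s * d)).trans (dvd_of_eq (by linear_combination (-u * s) * hd))
      rcases hM a b with h | h
      · obtain ⟨u, hu, h⟩ := aux hs ht hsa htb h
        exact ⟨a, Ideal.mem_sup_left ha, u, hu, h⟩
      · obtain ⟨u, hu, h⟩ := aux ht hs htb hsa h
        exact ⟨b, Ideal.mem_sup_right hb, u, hu, by rwa [sup_comm]⟩
  obtain ⟨a, ha, s, hs, h⟩ := key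
  refine ⟨a, ha, ?_, s, hs, h⟩
  rintro rfl
  refine hF0 (le_bot_iff.1 fun b hb => ?_)
  have := zero_dvd_iff.1 (h b hb)
  exact (mul_eq_zero.1 this).resolve_left fun h0 => hs (h0 ▸ M.zero_mem)

/-- The right side says that the generators of `I I⁻¹` do not all lie in a common maximal `t`-ideal.
In other words `I` is principal at each `M`, with one denominator `x` for all of `I`. -/
theorem isTInvertible_iff_forall {I : Ideal R} : IsTInvertible I ↔ I ≠ ⊥ ∧
    ∀ M : Ideal R, IsMaximalTIdeal M → ∃ x, x ∉ M ∧ ∃ a ∈ I, a ≠ 0 ∧ ∀ b ∈ I, a ∣ x * b := by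
  rw [isTInvertible_iff]
  refine and_congr_right fun hI => ⟨fun h M hM => ?_, fun h => ?_⟩
  · by_contra! hcon
    have hle : traceIdeal I ≤ M := by
      rw [traceIdeal, Ideal.span_le]
      rintro x ⟨a, haI, ha, hab⟩
      by_contra hx
      obtain ⟨b, hb, hb'⟩ := hcon x hx a haI ha
      exact hb' (hab b hb)
    have := (tcl_mono hle).trans hM.isTIdeal.tcl_le
    rw [h, top_le_iff] at this
    exact hM.ne_top this
  · by_contra hcon
    obtain ⟨M, hM, hle⟩ := exists_isMaximalTIdeal_of_tcl_ne_top (traceIdeal_ne_bot hI) hcon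
    obtain ⟨x, hx, a, haI, ha, hab⟩ := h M hM
    exact hx (hle (Ideal.subset_span ⟨a, haI, ha, hab⟩))

theorem isPvMD_iff : IsPvMD R ↔ ∀ M : Ideal R, IsMaximalTIdeal M → IsValuationAt M := by
  constructor
  · intro h M hM b c
    have hMp := hM.isPrime
    by_cases hbc : Ideal.span {b, c} = ⊥
    · rw [Ideal.span_eq_bot] at hbc
      have hc : c = 0 := hbc c (by simp)
      exact Or.inl ⟨1, M.one_notMem, by simp [hc]⟩
    obtain ⟨x, hx, a, haI, ha, hab⟩ := (isTInvertible_iff_forall.1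
      (h _ hbc (Submodule.fg_span (by simp)))).2 M hM
    obtain ⟨β, γ, rfl⟩ := Ideal.mem_span_pair.1 haI
    obtain ⟨b', hb'⟩ := hab b (Ideal.subset_span (by simp))
    obtain ⟨c', hc'⟩ := hab c (Ideal.subset_span (by simp))
    -- From `a = βb + γc`, `xb = ab'` and `xc = ac'`. As `x ∉ M`, one of `b'`, `c'` is a unit at
    -- `M`, and `b'c = c'b` then gives the divisibility.
    have hxe : x = β * b' + γ * c' := mul_left_cancel₀ ha (by linear_combination β * hb' + γ * hc')
    have hx0 : x ≠ 0 := fun h0 => hx (h0 ▸ M.zero_mem)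
    have hbc' : b' * c = c' * b := mul_left_cancel₀ (mul_ne_zero hx0 ha)
      (by linear_combination (β * b + γ * c) * (b' * hc' - c' * hb'))
    by_cases hb'M : b' ∈ M
    · refine Or.inr ⟨c', fun hc'M => hx ?_, ⟨b', by rw [← hbc', mul_comm]⟩⟩
      rw [hxe]
      exact add_mem (M.mul_mem_left _ hb'M) (M.mul_mem_left _ hc'M)
    · exact Or.inl ⟨b', hb'M, ⟨c', by rw [hbc', mul_comm]⟩⟩
  · intro h I hI hIfg
    refine isTInvertible_iff_forall.2 ⟨hI, fun M hM => ?_⟩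
    have hMp := hM.isPrime
    obtain ⟨a, haI, ha, s, hs, hsa⟩ := (h M hM).exists_generator hIfg hI
    exact ⟨s, hs, a, haI, ha, hsa⟩

/-- A finitely generated `G ≤ I I⁻¹` already has `1 ∈ G_v`, and each element of `G` multiplies `I`
into a finitely generated subideal of `I`. Collecting these gives `F` with `G I ≤ F`. -/
theorem IsTInvertible.exists_fg {I : Ideal R} (hI : IsTInvertible I) :
    ∃ F : Ideal R, F.FG ∧ F ≤ I ∧ I ≤ tcl F := by
  have h1 := (isTInvertible_iff.1 hI).2
  obtain ⟨G, hG, hGI, h1⟩ : (1 : R) ∈ tcl (traceIdeal I) := h1 ▸ Submodule.mem_top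
  have key : ∃ F : Ideal R, F.FG ∧ F ≤ I ∧ ∀ x ∈ G, ∀ b ∈ I, x * b ∈ F := by
    clear h1
    induction G, hG using Submodule.fg_induction with
    | singleton x =>
      have hx := hGI (Submodule.mem_span_singleton_self x)
      have : ∃ F : Ideal R, F.FG ∧ F ≤ I ∧ ∀ b ∈ I, x * b ∈ F := by
        clear hGI
        induction hx using Submodule.span_induction with
        | mem x hx =>
          obtain ⟨a, haI, -, hab⟩ := hx
          exact ⟨Ideal.span {a}, Submodule.fg_span_singleton a,
            (Ideal.span_singleton_le_iff_mem _).2 haI,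
            fun b hb => Ideal.mem_span_singleton.2 (hab b hb)⟩
        | zero => exact ⟨⊥, Submodule.fg_bot, bot_le, by simp⟩
        | add x y _ _ hx hy =>
          obtain ⟨F₁, hF₁, hFI₁, h₁⟩ := hx
          obtain ⟨F₂, hF₂, hFI₂, h₂⟩ := hy
          refine ⟨F₁ ⊔ F₂, Submodule.FG.sup hF₁ hF₂, sup_le hFI₁ hFI₂, fun b hb => ?_⟩
          rw [add_mul]
          exact add_mem (Ideal.mem_sup_left (h₁ b hb)) (Ideal.mem_sup_right (h₂ b hb))
        | smul c x _ hx =>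
          obtain ⟨F, hF, hFI, h⟩ := hx
          refine ⟨F, hF, hFI, fun b hb => ?_⟩
          rw [smul_eq_mul, mul_assoc]
          exact F.mul_mem_left c (h b hb)
      obtain ⟨F, hF, hFI, h⟩ := this
      refine ⟨F, hF, hFI, fun y hy b hb => ?_⟩
      obtain ⟨c, rfl⟩ := Ideal.mem_span_singleton.1 hy
      rw [mul_right_comm]
      exact F.mul_mem_right c (h b hb)
    | sup G₁ G₂ _ _ h₁ h₂ =>
      obtain ⟨F₁, hF₁, hFI₁, h₁⟩ := h₁ (le_sup_left.trans hGI)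
      obtain ⟨F₂, hF₂, hFI₂, h₂⟩ := h₂ (le_sup_right.trans hGI)
      refine ⟨F₁ ⊔ F₂, Submodule.FG.sup hF₁ hF₂, sup_le hFI₁ hFI₂, fun x hx b hb => ?_⟩
      obtain ⟨y, hy, z, hz, rfl⟩ := Submodule.mem_sup.1 hx
      rw [add_mul]
      exact add_mem (Ideal.mem_sup_left (h₁ y hy b hb)) (Ideal.mem_sup_right (h₂ z hz b hb))
  obtain ⟨F, hF, hFI, h⟩ := key
  refine ⟨F, hF, hFI, fun b hb => ?_⟩
  exact ⟨F, hF, le_rfl, mem_vcl_of_one_mem_vcl h1 fun x hx => h x hx b hb⟩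

end LocalDivisibility

/-! ### Factoring `t`-ideals in an independent ring of Krull type, and `t`-invertibility of factors.
-/

section KrullTypeFactorization

variable {R : Type*} [CommRing R] [IsDomain R]

/-- One of `x^n`, `y^n` divides the other in `V`; thus `x^n y^n ∈ I` forces `x^(2n)` or `y^(2n)`
into `I`. -/
theorem IsValuationIdeal.isPrime_radical {I : Ideal R} (hI : IsValuationIdeal I) (hI' : I ≠ ⊤) :
    I.radical.IsPrime := by
  obtain ⟨V, -, hV⟩ := isValuationIdeal_iff.1 hI
  refine ⟨fun h => hI' (Ideal.radical_eq_top.1 h), ?_⟩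
  rintro x y ⟨n, hn⟩
  rw [mul_pow] at hn
  rcases le_total (V.valuation (algebraMap R _ (x ^ n))) (V.valuation (algebraMap R _ (y ^ n)))
    with h | h
  · refine Or.inl ⟨n + n, hV _ _ hn ?_⟩
    rw [pow_add, map_mul, map_mul, map_mul, map_mul]
    gcongr
  · refine Or.inr ⟨n + n, hV _ _ hn ?_⟩
    rw [pow_add, map_mul, map_mul, map_mul, map_mul]
    gcongr

/-- The contraction to `R` of the extension of `I` to the localization at `M`. -/
def localContraction (M : Ideal R) (hM : M.IsPrime) (I : Ideal R) : Ideal R where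
  carrier := {x | ∃ s, s ∉ M ∧ s * x ∈ I}
  zero_mem' := ⟨1, M.one_notMem, by simp⟩
  add_mem' := by
    rintro x y ⟨s, hs, hx⟩ ⟨t, ht, hy⟩
    refine ⟨s * t, hM.mul_notMem hs ht, ?_⟩
    rw [mul_add]
    refine add_mem ?_ ?_
    · rw [mul_right_comm]; exact I.mul_mem_right _ hx
    · rw [mul_assoc]; exact I.mul_mem_left _ hy
  smul_mem' := by
    rintro c x ⟨s, hs, hx⟩
    exact ⟨s, hs, by rw [smul_eq_mul, mul_left_comm]; exact I.mul_mem_left _ hx⟩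

theorem le_localContraction (M : Ideal R) (hM : M.IsPrime) (I : Ideal R) :
    I ≤ localContraction M hM I := fun x hx => ⟨1, M.one_notMem, by simpa using hx⟩

/-- The localization at a prime `M` as a valuation subring of the quotient field. -/
def IsValuationAt.valuationSubring {M : Ideal R} (hM : M.IsPrime) (h : IsValuationAt M) :
    ValuationSubring (FractionRing R) where
  carrier := {x | ∃ r s : R, s ∉ M ∧
    x * algebraMap R (FractionRing R) s = algebraMap R (FractionRing R) r}
  mul_mem' := by
    rintro x y ⟨r, s, hs, hx⟩ ⟨r', s', hs', hy⟩
    exact ⟨r * r', s * s', hM.mul_notMem hs hs', by rw [map_mul, map_mul, ← hx, ← hy]; ring⟩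
  one_mem' := ⟨1, 1, M.one_notMem, by simp⟩
  add_mem' := by
    rintro x y ⟨r, s, hs, hx⟩ ⟨r', s', hs', hy⟩
    exact ⟨r * s' + r' * s, s * s', hM.mul_notMem hs hs', by
      rw [map_mul, map_add, map_mul, map_mul, ← hx, ← hy]; ring⟩
  zero_mem' := ⟨0, 1, M.one_notMem, by simp⟩
  neg_mem' := by
    rintro x ⟨r, s, hs, hx⟩
    exact ⟨-r, s, hs, by rw [map_neg, ← hx]; ring⟩
  mem_or_inv_mem' := by
    intro x
    have hinj := IsFractionRing.injective R (FractionRing R)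
    obtain ⟨b, c, hc, rfl⟩ := IsFractionRing.div_surjective (A := R) x
    have hc0 := nonZeroDivisors.ne_zero hc
    have hc' : algebraMap R (FractionRing R) c ≠ 0 := (map_ne_zero_iff _ hinj).2 hc0
    rcases h b c with ⟨s, hs, d, hd⟩ | ⟨s, hs, d, hd⟩
    · right
      by_cases hb : b = 0
      · exact ⟨0, 1, M.one_notMem, by simp [hb]⟩
      have hb' : algebraMap R (FractionRing R) b ≠ 0 := (map_ne_zero_iff _ hinj).2 hb
      refine ⟨d, s, hs, ?_⟩
      have := congrArg (algebraMap R (FractionRing R)) hd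
      rw [map_mul, map_mul] at this
      field_simp
      linear_combination this
    · left
      refine ⟨d, s, hs, ?_⟩
      have := congrArg (algebraMap R (FractionRing R)) hd
      rw [map_mul, map_mul] at this
      field_simp
      linear_combination this

theorem IsValuationAt.isValuationIdeal_localContraction {M : Ideal R} (hM : M.IsPrime)
    (h : IsValuationAt M) (I : Ideal R) : IsValuationIdeal (localContraction M hM I) := by
  rw [isValuationIdeal_iff]
  refine ⟨h.valuationSubring hM, fun r => ⟨r, 1, M.one_notMem, by simp⟩, ?_⟩
  rintro r a ⟨t, ht, hta⟩ hra
  obtain ⟨⟨c, r', s, hs, hc⟩, hca⟩ := (ValuationSubring.valuation_le_iff _ _ _).1 hra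
  have key : s * r = r' * a := by
    apply IsFractionRing.injective R (FractionRing R)
    rw [map_mul, map_mul, ← hc, ← hca]
    ring
  refine ⟨t * s, hM.mul_notMem ht hs, ?_⟩
  have : t * s * r = r' * (t * a) := by linear_combination t * key
  rw [this]
  exact I.mul_mem_left _ hta

theorem isValuationIdeal_top : IsValuationIdeal (⊤ : Ideal R) :=
  isValuationIdeal_iff.2 ⟨⊤, fun _ => trivial, fun _ _ _ _ => trivial⟩

/-- Lets the uniqueness clause of `IsWeaklyMatlis`, which concerns prime `t`-ideals only, be used
for all nonzero primes. -/
theorem exists_isTIdeal_le {P : Ideal R} (hP : P.IsPrime) (hP0 : P ≠ ⊥) :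
    ∃ Q ≤ P, Q.IsPrime ∧ IsTIdeal Q := by
  obtain ⟨b, hbP, hb⟩ := Submodule.exists_mem_ne_zero_of_ne_bot hP0
  obtain ⟨Q, hQ, hQP⟩ := Ideal.exists_minimalPrimes_le
    ((Ideal.span_singleton_le_iff_mem _).2 hbP)
  exact ⟨Q, hQP, hQ.1.1, isTIdeal_of_mem_minimalPrimes hb hQ⟩

theorem IsWeaklyMatlis.eq_of_le (h : IsWeaklyMatlis R) {P M N : Ideal R} (hP : P.IsPrime)
    (hP0 : P ≠ ⊥) (hM : IsMaximalTIdeal M) (hN : IsMaximalTIdeal N) (hPM : P ≤ M) (hPN : P ≤ N) :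
    M = N := by
  obtain ⟨Q, hQP, hQ, hQt⟩ := exists_isTIdeal_le hP hP0
  exact (h.2 Q hQ hQt).unique ⟨hM, hQP.trans hPM⟩ ⟨hN, hQP.trans hPN⟩

theorem IsIndependentRingOfKrullType.isTProductOfValuationIdeals
    (h : IsIndependentRingOfKrullType R) {I : Ideal R} (hI : IsTIdeal I) :
    IsTProductOfValuationIdeals I := by
  classical
  rw [isTProductOfValuationIdeals_iff hI.ne_bot]
  by_cases htop : I = ⊤
  · subst htop
    refine ⟨1, one_pos, fun _ => ⊤, fun _ => isValuationIdeal_top, ?_, ?_⟩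
    · simp
    · simpa using top_le_iff.1 (le_tcl (⊤ : Ideal R))
  have hval := isPvMD_iff.1 h.2
  obtain ⟨a, haI, ha⟩ := Submodule.exists_mem_ne_zero_of_ne_bot hI.ne_bot
  have hfin : {M : Ideal R | IsMaximalTIdeal M ∧ I ≤ M}.Finite := by
    refine (h.1.1 a ha fun hu => htop (Ideal.eq_top_of_isUnit_mem _ haI hu)).subset ?_
    rintro M ⟨hM, hIM⟩
    exact ⟨hM, hIM haI⟩
  let T := {M : Ideal R // IsMaximalTIdeal M ∧ I ≤ M}
  have : Fintype T := hfin.fintype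
  let J : T → Ideal R := fun M => localContraction M.1 M.2.1.isPrime I
  have hJM : ∀ M : T, J M ≤ M.1 := by
    rintro ⟨M, hM, hIM⟩ x ⟨s, hs, hsx⟩
    exact (hM.isPrime.mem_or_mem (hIM hsx)).resolve_left hs
  have hJval : ∀ M, IsValuationIdeal (J M) := fun M =>
    (hval M.1 M.2.1).isValuationIdeal_localContraction _ I
  have hIJ : ∀ M, I ≤ J M := fun M => le_localContraction _ _ I
  have hJ0 : ∀ M, J M ≠ ⊥ := fun M h0 => hI.ne_bot (le_bot_iff.1 (h0 ▸ hIJ M))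
  -- The radical of `J M` is a nonzero prime inside `M`, so independence leaves no other maximal
  -- `t`-ideal above it.
  have huniq : ∀ (M : T) (N : Ideal R), IsMaximalTIdeal N → J M ≤ N → M.1 = N := by
    intro M N hN hMN
    refine h.1.eq_of_le ((hJval M).isPrime_radical fun h' => ?_)
      (fun h' => hJ0 M (le_bot_iff.1 (h' ▸ Ideal.le_radical))) M.2.1 hN
      (M.2.1.isPrime.radical_le_iff.2 (hJM M)) (hN.isPrime.radical_le_iff.2 hMN)
    exact M.2.1.ne_top (top_le_iff.1 (h' ▸ hJM M))
  have hprod0 : ∏ M, J M ≠ ⊥ := Finset.prod_ne_zero_iff.2 fun M _ => hJ0 M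
  have hprod : tcl (∏ M, J M) = I := by
    apply le_antisymm
    · refine (tcl_mono fun x hx => hI.tcl_le ?_).trans hI.tcl_le
      refine mem_tcl_of_forall_isMaximalTIdeal hI.ne_bot fun N hN => ?_
      by_cases hIN : I ≤ N
      · exact Ideal.le_of_dvd (Finset.dvd_prod_of_mem J (Finset.mem_univ (⟨N, hN, hIN⟩ : T))) hx
      · obtain ⟨b, hb, hbN⟩ := SetLike.not_le_iff_exists.1 hIN
        exact ⟨b, hbN, I.mul_mem_right _ hb⟩
    · intro x hx
      refine mem_tcl_of_forall_isMaximalTIdeal hprod0 fun N hN => ?_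
      -- At `N`, every factor `J M` with `M ≠ N` contains a unit `y M`, so only the factor at `N`,
      -- if there is one, matters.
      have hy : ∀ M : T, ∃ y ∈ J M, M.1 ≠ N → y ∉ N := by
        intro M
        by_cases hMN : M.1 = N
        · exact ⟨0, zero_mem _, fun h' => absurd hMN h'⟩
        · obtain ⟨y, hy, hyN⟩ := SetLike.not_le_iff_exists.1 fun h' => hMN (huniq M N hN h')
          exact ⟨y, hy, fun _ => hyN⟩
      choose y hyJ hyN using hy
      have hNp := hN.isPrime
      by_cases hIN : I ≤ N
      · let N' : T := ⟨N, hN, hIN⟩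
        refine ⟨∏ M ∈ Finset.univ.erase N', y M, ?_, ?_⟩
        · rw [hNp.prod_mem_iff]
          rintro ⟨M, hM, hyM⟩
          exact hyN M (fun h' => (Finset.mem_erase.1 hM).1 (Subtype.ext h')) hyM
        · rw [← Finset.prod_erase_mul _ _ (Finset.mem_univ N')]
          exact Ideal.mul_mem_mul (Ideal.prod_mem_prod fun M _ => hyJ M) (hIJ N' hx)
      · refine ⟨∏ M, y M, ?_, Ideal.mul_mem_right _ _ (Ideal.prod_mem_prod fun M _ => hyJ M)⟩
        rw [hNp.prod_mem_iff]
        rintro ⟨M, -, hyM⟩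
        exact hyN M (fun h' => hIN (h' ▸ M.2.2)) hyM
  obtain ⟨M₀, hM₀, hIM₀⟩ := exists_isMaximalTIdeal hI htop
  have : Nonempty T := ⟨⟨M₀, hM₀, hIM₀⟩⟩
  refine ⟨Fintype.card T, Fintype.card_pos, fun i => J ((Fintype.equivFin T).symm i),
    fun i => hJval _, ?_, ?_⟩
  · rwa [(Fintype.equivFin T).symm.prod_comp J]
  · rwa [(Fintype.equivFin T).symm.prod_comp J]

theorem isTVIFD_of_forall (h : ∀ I : Ideal R, IsTIdeal I → IsTProductOfValuationIdeals I) :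
    IsTVIFD R := fun _ ha => h _ (isTIdeal_span_singleton ha)

/-- Cancellation of `a`: a finitely generated `F ≤ aT` is `a` times its preimage under
multiplication by `a`, which is again finitely generated by injectivity. -/
theorem mem_tcl_of_mul_mem_tcl {a x : R} (ha : a ≠ 0) {T A : Ideal R}
    (hA : ∀ y ∈ A, ∃ t ∈ T, y = a * t) (h : a * x ∈ tcl A) : x ∈ tcl T := by
  obtain ⟨F, hF, hFA, hx⟩ := h
  have hinj : Function.Injective (LinearMap.mulLeft R a) := fun y z hyz => mul_left_cancel₀ ha hyz
  have hmap : (Submodule.comap (LinearMap.mulLeft R a) F).map (LinearMap.mulLeft R a) = F := by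
    rw [Submodule.map_comap_eq, inf_eq_right]
    intro y hy
    obtain ⟨t, -, rfl⟩ := hA y (hFA hy)
    exact ⟨t, rfl⟩
  refine ⟨Submodule.comap (LinearMap.mulLeft R a) F, ?_, ?_, ?_⟩
  · exact Submodule.fg_of_fg_map_injective _ hinj (by rw [hmap]; exact hF)
  · intro y hy
    obtain ⟨t, ht, hyt⟩ := hA _ (hFA hy)
    rwa [mul_left_cancel₀ ha hyt]
  · intro r s hs hb
    have := hx r (s * a) (mul_ne_zero hs ha) fun f hf => by
      obtain ⟨t, -, rfl⟩ := hA f (hFA hf)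
      rw [mul_left_comm, mul_comm s]
      exact mul_dvd_mul_left a (hb t hf)
    rw [mul_left_comm, mul_comm s] at this
    exact (mul_dvd_mul_iff_left ha).1 this

/-- Since `J ⊆ a I⁻¹`, the product `I J` lies in `a (I I⁻¹)`; cancelling `a` puts `1` in the
`t`-closure of `I I⁻¹`. -/
theorem isTInvertible_of_tcl_mul_eq {a : R} (ha : a ≠ 0) {I J : Ideal R} (hI : I ≠ ⊥)
    (h : tcl (I * J) = Ideal.span {a}) : IsTInvertible I := by
  have hle : I * J ≤ Ideal.span {a} := h ▸ le_tcl _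
  rw [isTInvertible_iff]
  refine ⟨hI, (Ideal.eq_top_iff_one _).2 (mem_tcl_of_mul_mem_tcl ha (A := I * J) ?_ ?_)⟩
  · intro y hy
    induction hy using Submodule.mul_induction_on' with
    | mem_mul_mem j hj b hb =>
      obtain ⟨c, hc⟩ := Ideal.mem_span_singleton.1 (hle (Ideal.mul_mem_mul hj hb))
      refine ⟨c, ?_, hc⟩
      by_cases hj0 : j = 0
      · have : c = 0 := by
          rw [hj0, zero_mul] at hc
          exact (mul_eq_zero.1 hc.symm).resolve_left ha
        rw [this]; exact zero_mem _
      · refine Ideal.subset_span ⟨j, hj, hj0, fun b' hb' => ?_⟩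
        obtain ⟨c', hc'⟩ := Ideal.mem_span_singleton.1 (hle (Ideal.mul_mem_mul hb' hb))
        refine ⟨c', mul_left_cancel₀ ha ?_⟩
        linear_combination (-b') * hc + j * hc'
    | add x _ y _ hx hy =>
      obtain ⟨t, ht, rfl⟩ := hx
      obtain ⟨u, hu, rfl⟩ := hy
      exact ⟨t + u, add_mem ht hu, by ring⟩
  · rw [mul_one, h]
    exact Ideal.mem_span_singleton_self a

theorem IsTVIFD.exists_isTInvertible_le (h : IsTVIFD R) {P : Ideal R} (hP : P.IsPrime)
    (hP0 : P ≠ ⊥) : ∃ I : Ideal R, IsTInvertible I ∧ IsValuationIdeal I ∧ I ≤ P := by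
  obtain ⟨a, haP, ha⟩ := Submodule.exists_mem_ne_zero_of_ne_bot hP0
  obtain ⟨n, -, J, hJ, hJ0, hJa⟩ := (isTProductOfValuationIdeals_iff (by simpa using ha)).1 (h a ha)
  have hle : ∏ i, J i ≤ P := (le_tcl _).trans
    (hJa.le.trans ((Ideal.span_singleton_le_iff_mem _).2 haP))
  obtain ⟨i, -, hi⟩ := (hP.prod_le).1 hle
  refine ⟨J i, ?_, hJ i, hi⟩
  rw [← Finset.mul_prod_erase _ _ (Finset.mem_univ i)] at hJa
  exact isTInvertible_of_tcl_mul_eq ha (Finset.prod_ne_zero_iff.1 hJ0 i (Finset.mem_univ i)) hJa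

end KrullTypeFactorization

end TIdeals

namespace TIdeals

/-! ### From `t`-invertible valuation ideals in `t`-treed domains to Krull type. -/

section Treed

variable {R : Type*} [CommRing R] [IsDomain R]

/-- The hypothesis compares prime `t`-ideals only. For incomparable `P`, `Q` with `x ∈ P \ Q` and `y
∈ Q \ P`, minimal primes over `x` in `P` and over `y` in `Q` are `t`-ideals and still incomparable.
-/
theorem IsTTreed.le_or_le (hR : IsTTreed R) {M : Ideal R} (hM : M.IsPrime) (hMt : IsTIdeal M)
    {P Q : Ideal R} (hP : P.IsPrime) (hQ : Q.IsPrime) (hPM : P ≤ M) (hQM : Q ≤ M) :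
    P ≤ Q ∨ Q ≤ P := by
  by_contra! h
  obtain ⟨x, hxP, hxQ⟩ := SetLike.not_le_iff_exists.1 h.1
  obtain ⟨y, hyQ, hyP⟩ := SetLike.not_le_iff_exists.1 h.2
  obtain ⟨P', hP', hPP'⟩ := Ideal.exists_minimalPrimes_le
    ((Ideal.span_singleton_le_iff_mem _).2 hxP)
  obtain ⟨Q', hQ', hQQ'⟩ := Ideal.exists_minimalPrimes_le
    ((Ideal.span_singleton_le_iff_mem _).2 hyQ)
  rcases hR P' Q' M hP'.1.1 hQ'.1.1 hM
    (isTIdeal_of_mem_minimalPrimes (ne_of_mem_of_not_mem Q.zero_mem hxQ).symm hP')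
    (isTIdeal_of_mem_minimalPrimes (ne_of_mem_of_not_mem P.zero_mem hyP).symm hQ') hMt
    (hPP'.trans hPM) (hQQ'.trans hQM) with h' | h'
  · exact hxQ (hQQ' (h' (hP'.1.2 (Ideal.mem_span_singleton_self x))))
  · exact hyP (hPP' (h' (hQ'.1.2 (Ideal.mem_span_singleton_self y))))

local notation "ι" => algebraMap R (FractionRing R)

/-- The element `b` generates a valuation ideal in the localization at `M`, for the localization
of the valuation ring `V` at `M`. -/
def IsValuationElementAt (V : ValuationSubring (FractionRing R)) (M : Ideal R) (b : R) : Prop :=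
  ∀ x s : R, s ∉ M → V.valuation (ι (s * x)) ≤ V.valuation (ι b) → DvdAt M b x

variable {V : ValuationSubring (FractionRing R)}
  (hV : ∀ r : R, algebraMap R (FractionRing R) r ∈ V) {M : Ideal R}

include hV in
theorem valuation_mul_le (s x : R) : V.valuation (ι (s * x)) ≤ V.valuation (ι x) := by
  rw [map_mul, map_mul]
  exact mul_le_of_le_one_left' ((V.valuation_le_one_iff _).2 (hV s))

theorem valuation_pos {a : R} (ha : a ≠ 0) : 0 < V.valuation (ι a) := by
  rw [zero_lt_iff, Valuation.ne_zero_iff]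
  exact (map_ne_zero_iff _ (IsFractionRing.injective R (FractionRing R))).2 ha

theorem valuation_le_of_mul_le {a x y : R} (ha : a ≠ 0)
    (h : V.valuation (ι (a * x)) ≤ V.valuation (ι (a * y))) :
    V.valuation (ι x) ≤ V.valuation (ι y) := by
  rw [map_mul, map_mul, map_mul, map_mul] at h
  exact (mul_le_mul_iff_right₀ (valuation_pos ha)).1 h

variable [hMp : M.IsPrime]

include hV in
theorem IsValuationElementAt.pow {a : R} (ha : a ≠ 0) (h : IsValuationElementAt V M a) (k : ℕ) :
    IsValuationElementAt V M (a ^ k) := by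
  induction k with
  | zero => exact fun x _ _ _ => ⟨1, M.one_notMem, by simp⟩
  | succ k ih =>
    intro x s hs hx
    obtain ⟨t, ht, x', hx'⟩ := h x s hs (hx.trans (by rw [pow_succ]; exact valuation_mul_le hV _ _))
    obtain ⟨u, hu, y, hy⟩ := ih x' s hs (valuation_le_of_mul_le (V := V) ha (by
      have h1 : a * (s * x') = t * (s * x) := by linear_combination (-s) * hx'
      rw [h1, ← pow_succ']
      exact (valuation_mul_le hV _ _).trans hx))
    refine ⟨u * t, hMp.mul_notMem hu ht, y, ?_⟩
    linear_combination u * hx' + a * hy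

-- Local divisors inherit the property: if `sc = bd`, then `x / b` equals `dx / (sc)`.
include hV in
theorem IsValuationElementAt.of_mul_eq {b c d s : R} (hc : c ≠ 0) (hs : s ∉ M)
    (h : IsValuationElementAt V M c) (hbd : s * c = b * d) : IsValuationElementAt V M b := by
  intro x t ht hx
  have hs0 : s ≠ 0 := fun h0 => hs (h0 ▸ M.zero_mem)
  obtain ⟨u, hu, y, hy⟩ := h (d * x) t ht (by
    have h1 : V.valuation (ι (t * (d * x))) ≤ V.valuation (ι (s * c)) := by
      have h2 : t * (d * x) = d * (t * x) := by ring
      rw [h2, hbd, mul_comm b, map_mul _ d (t * x), map_mul _ d b, map_mul V.valuation,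
        map_mul V.valuation]
      exact mul_le_mul_right hx _
    exact h1.trans (valuation_mul_le hV _ _))
  refine ⟨u * s, hMp.mul_notMem hu hs, y, mul_left_cancel₀ hc ?_⟩
  linear_combination u * x * hbd + b * hy

-- If `c` is at least as divisible as `b` in `V`, then `b` divides `c` locally. Otherwise
-- multiplying `s b^k = c e` by `b` shows `e ∈ b^(k-1) V`; so `b^(k-1)` divides `e` locally, and
-- cancelling it leaves `c` dividing `b`.
include hV in
theorem IsValuationElementAt.dvdAt_or {b c e s : R} {k : ℕ} (hb : b ≠ 0) (hs : s ∉ M)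
    (h : IsValuationElementAt V M b) (hce : s * b ^ k = c * e) : DvdAt M b c ∨ DvdAt M c b := by
  rcases le_total (V.valuation (ι c)) (V.valuation (ι b)) with hcb | hbc
  · exact Or.inl (h c 1 M.one_notMem (by rwa [one_mul]))
  · right
    cases k with
    | zero => exact ⟨s, hs, e * b, by linear_combination b * hce⟩
    | succ k =>
      obtain ⟨t, ht, d, hd⟩ := h.pow hV hb k e 1 M.one_notMem (by
        rw [one_mul]
        refine le_trans ?_ (valuation_mul_le hV s _)
        refine valuation_le_of_mul_le hb ?_
        have h1 : b * (s * b ^ k) = c * e := by rw [← hce]; ring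
        rw [h1, map_mul, map_mul, map_mul (algebraMap R _) c e, map_mul]
        gcongr)
      refine ⟨t * s, hMp.mul_notMem ht hs, d, mul_left_cancel₀ (pow_ne_zero k hb) ?_⟩
      linear_combination t * hce + c * hd

omit hMp in
theorem exists_isValuationElementAt {I : Ideal R} (hI : IsTInvertible I)
    (hIv : IsValuationIdeal I) (hM : IsMaximalTIdeal M) :
    ∃ V : ValuationSubring (FractionRing R), (∀ r, ι r ∈ V) ∧
      ∃ a ∈ I, a ≠ 0 ∧ IsValuationElementAt V M a := by
  have hMp := hM.isPrime
  obtain ⟨V, hV, hVI⟩ := isValuationIdeal_iff.1 hIv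
  obtain ⟨t, ht, a, haI, ha, hta⟩ := (isTInvertible_iff_forall.1 hI).2 M hM
  refine ⟨V, hV, a, haI, ha, fun x s hs hx => ⟨t * s, hMp.mul_notMem ht hs, ?_⟩⟩
  rw [mul_assoc]
  exact hta _ (hVI _ a haI hx)

theorem isPvMD_of_isTTreed (hR : IsTTreed R) (h : ∀ P : Ideal R, P.IsPrime → P ≠ ⊥ →
    ∃ I : Ideal R, IsTInvertible I ∧ IsValuationIdeal I ∧ I ≤ P) : IsPvMD R := by
  rw [isPvMD_iff]
  intro M hM
  have hMp := hM.isPrime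
  have hchain := fun {P Q : Ideal R} => hR.le_or_le hMp hM.isTIdeal (P := P) (Q := Q)
  have key : ∀ b : R, b ≠ 0 → ∃ V : ValuationSubring (FractionRing R), (∀ r, ι r ∈ V) ∧
      IsValuationElementAt V M b := by
    intro b hb
    by_cases hbM : b ∈ M
    · obtain ⟨P, hP, hPM⟩ := Ideal.exists_minimalPrimes_le
        ((Ideal.span_singleton_le_iff_mem _).2 hbM)
      have hbP : b ∈ P := hP.1.2 (Ideal.mem_span_singleton_self b)
      obtain ⟨I, hI, hIv, hIP⟩ := h P hP.1.1 fun h0 => hb (by simpa [h0] using hbP)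
      obtain ⟨V, hV, a, haI, ha, hVa⟩ := exists_isValuationElementAt hI hIv hM
      -- Primes inside `M` form a chain, so each one containing `b` contains the minimal prime `P`,
      -- hence `a`; thus `b` divides a power of `a` locally.
      obtain ⟨s, hs, k, d, hd⟩ := exists_dvd_mul_pow (P := M) (b := b) (c := a)
        fun Q hQ hQM hbQ => by
          rcases hchain hQ hP.1.1 hQM hPM with h' | h'
          · exact hP.2 ⟨hQ, (Ideal.span_singleton_le_iff_mem _).2 hbQ⟩ h' (hIP haI)
          · exact h' (hIP haI)
      exact ⟨V, hV, (hVa.pow hV ha k).of_mul_eq hV (pow_ne_zero k ha) hs hd⟩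
    · exact ⟨⊤, fun _ => trivial, fun x s _ _ => ⟨b, hbM, dvd_mul_right b x⟩⟩
  have hcomp : ∀ b c : R, b ≠ 0 →
      (∀ Q : Ideal R, Q.IsPrime → Q ≤ M → c ∈ Q → b ∈ Q) → DvdAt M b c ∨ DvdAt M c b := by
    intro b c hb hbc
    obtain ⟨V, hV, hVb⟩ := key b hb
    obtain ⟨s, hs, k, e, he⟩ := exists_dvd_mul_pow hbc
    exact hVb.dvdAt_or hV hb hs he
  intro b c
  by_cases hb : b = 0
  · exact Or.inr ⟨1, M.one_notMem, by simp [hb]⟩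
  by_cases hc : c = 0
  · exact Or.inl ⟨1, M.one_notMem, by simp [hc]⟩
  -- By the chain condition, one of `b`, `c` lies locally in the radical of the ideal generated by
  -- the other.
  by_cases hbc : ∀ Q : Ideal R, Q.IsPrime → Q ≤ M → c ∈ Q → b ∈ Q
  · exact hcomp b c hb hbc
  · push Not at hbc
    obtain ⟨P, hP, hPM, hcP, hbP⟩ := hbc
    refine (hcomp c b hc fun Q hQ hQM hbQ => ?_).symm
    rcases hchain hP hQ hPM hQM with h' | h'
    · exact h' hcP
    · exact absurd (h' hbQ) hbP

omit hMp in
theorem IsTInvertible.isTInvertible_tcl {I : Ideal R} (hI : IsTInvertible I) : IsTInvertible (tcl I) := by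
  rw [isTInvertible_iff_forall] at hI ⊢
  refine ⟨(isTIdeal_tcl hI.1).ne_bot, fun M hM => ?_⟩
  obtain ⟨x, hx, a, haI, ha, hab⟩ := hI.2 M hM
  refine ⟨x, hx, a, le_tcl I haI, ha, fun b hb => ?_⟩
  rw [← Ideal.mem_span_singleton]
  refine (isTIdeal_span_singleton ha).tcl_le
    (tcl_mono ?_ (mul_mem_tcl_mul (le_tcl _ (Ideal.mem_span_singleton_self x)) hb))
  rw [Ideal.mul_le]
  intro y hy c hc
  obtain ⟨d, rfl⟩ := Ideal.mem_span_singleton.1 hy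
  rw [Ideal.mem_span_singleton, mul_right_comm]
  exact (hab c hc).mul_right d

-- The valuation ring of `I` also serves for `L`. Locally `I = (a)`, `L = (c)` and `a = cd`; if `r`
-- has value at most that of some `l ∈ L`, then `rd` has value at most that of `a`, so `rd ∈ I` and
-- `c` divides `r`.
omit hMp in
theorem IsValuationIdeal.of_le {I L : Ideal R} (hI : IsTInvertible I) (hIv : IsValuationIdeal I)
    (hL : IsTInvertible L) (hLt : IsTIdeal L) (hIL : I ≤ L) : IsValuationIdeal L := by
  obtain ⟨V, hV, hVI⟩ := isValuationIdeal_iff.1 hIv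
  refine isValuationIdeal_iff.2 ⟨V, hV, fun r l hl hrl => hLt.tcl_le
    (mem_tcl_of_forall_isMaximalTIdeal hLt.ne_bot fun M hM => ?_)⟩
  have hMp := hM.isPrime
  obtain ⟨s, hs, a, haI, ha, hsa⟩ := (isTInvertible_iff_forall.1 hI).2 M hM
  obtain ⟨t, ht, c, hcL, hc, htc⟩ := (isTInvertible_iff_forall.1 hL).2 M hM
  obtain ⟨d, hd⟩ := htc a (hIL haI)
  obtain ⟨e, he⟩ := htc l hl
  have hrd : r * d ∈ I := by
    refine hVI _ a haI (valuation_le_of_mul_le hc ?_)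
    calc V.valuation (ι (c * (r * d))) = V.valuation (ι (t * a)) * V.valuation (ι r) := by
          rw [← map_mul, ← map_mul]
          congr 2
          linear_combination (-r) * hd
      _ ≤ V.valuation (ι (t * a)) * V.valuation (ι l) := by gcongr
      _ = V.valuation (ι (e * (c * a))) := by
          rw [← map_mul, ← map_mul]
          congr 2
          linear_combination a * he
      _ ≤ _ := valuation_mul_le hV _ _
  obtain ⟨f, hf⟩ := hsa _ hrd
  refine ⟨s * t, hMp.mul_notMem hs ht, ?_⟩
  have : s * t * r = c * f := mul_left_cancel₀ ha (by linear_combination s * r * hd + c * hf)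
  rw [this]
  exact L.mul_mem_right _ hcL

-- With `x ∈ M \ N` and `y ∈ N \ M`, enlarging `I` by `xy` keeps a `t`-invertible valuation ideal
-- inside `M ∩ N`. Its radical is prime and contains `xy`, hence `x` or `y`, which is absurd.
omit hMp in
theorem IsPvMD.eq_of_le_of_isValuationIdeal (hR : IsPvMD R) {I : Ideal R} (hI : IsTInvertible I)
    (hIv : IsValuationIdeal I) {M N : Ideal R} (hM : IsMaximalTIdeal M) (hN : IsMaximalTIdeal N)
    (hIM : I ≤ M) (hIN : I ≤ N) : M = N := by
  by_contra hne
  obtain ⟨x, hxM, hxN⟩ := SetLike.not_le_iff_exists.1 fun h =>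
    hne (hM.eq_of_le hN.isTIdeal hN.ne_top h)
  obtain ⟨y, hyN, hyM⟩ := SetLike.not_le_iff_exists.1 fun h =>
    hne (hN.eq_of_le hM.isTIdeal hM.ne_top h).symm
  obtain ⟨F, hF, hFI, hIF⟩ := hI.exists_fg
  have hfg : (F ⊔ Ideal.span {x * y}).FG := Submodule.FG.sup hF (Submodule.fg_span_singleton _)
  have hne : F ⊔ Ideal.span {x * y} ≠ ⊥ := by
    intro h
    have := (sup_eq_bot_iff.1 h).2
    rw [Ideal.span_singleton_eq_bot, mul_eq_zero] at this
    rcases this with rfl | rfl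
    · exact hxN N.zero_mem
    · exact hyM M.zero_mem
  have hLM : tcl (F ⊔ Ideal.span {x * y}) ≤ M := (tcl_mono (sup_le (hFI.trans hIM)
    ((Ideal.span_singleton_le_iff_mem _).2 (M.mul_mem_right _ hxM)))).trans hM.isTIdeal.tcl_le
  have hLN : tcl (F ⊔ Ideal.span {x * y}) ≤ N := (tcl_mono (sup_le (hFI.trans hIN)
    ((Ideal.span_singleton_le_iff_mem _).2 (N.mul_mem_left _ hyN)))).trans hN.isTIdeal.tcl_le
  have hLv : IsValuationIdeal (tcl (F ⊔ Ideal.span {x * y})) :=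
    IsValuationIdeal.of_le hI hIv (hR _ hne hfg).isTInvertible_tcl (isTIdeal_tcl hne)
      (hIF.trans (tcl_mono le_sup_left))
  have hprime := hLv.isPrime_radical fun h => hM.ne_top (top_le_iff.1 (h ▸ hLM))
  rcases hprime.mem_or_mem (Ideal.le_radical (le_tcl _
    (Ideal.mem_sup_right (Ideal.mem_span_singleton_self (x * y))))) with h | h
  · exact hxN (hN.isPrime.radical_le_iff.2 hLN h)
  · exact hyM (hM.isPrime.radical_le_iff.2 hLM h)

omit hMp in
theorem isIndependentRingOfKrullType_of_isTTreed (hR : IsTTreed R)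
    (h : ∀ P : Ideal R, P.IsPrime → P ≠ ⊥ →
      ∃ I : Ideal R, IsTInvertible I ∧ IsValuationIdeal I ∧ I ≤ P) :
    IsIndependentRingOfKrullType R := by
  have hPvMD := isPvMD_of_isTTreed hR h
  refine ⟨⟨fun a ha _ => ?_, fun P hP hPt => ?_⟩, hPvMD⟩
  · have hOka : Ideal.IsOka fun J : Ideal R => a ∈ J → ∃ F : Ideal R, F.FG ∧ F ≤ J ∧
        {M : Ideal R | IsMaximalTIdeal M ∧ F ≤ M}.Finite := by
      refine ⟨fun _ => ⟨⊤, ⟨{1}, by simp⟩, le_rfl, Set.finite_empty.subset ?_⟩, ?_⟩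
      · rintro M ⟨hM, hle⟩
        exact hM.ne_top (top_le_iff.1 hle)
      · intro J x h₁ h₂ ha
        obtain ⟨F₁, hF₁, hFJ₁, hfin₁⟩ := h₁ (Ideal.mem_sup_left ha)
        obtain ⟨F₂, hF₂, hFJ₂, hfin₂⟩ := h₂ (Ideal.le_colon ha)
        -- `G` collects the components in `J` of generators of `F₁ ≤ J + (x)`. A prime containing `G
        -- + x F₂` contains `F₁` if it contains `x`, and `F₂` otherwise.
        obtain ⟨G, hG, hGJ, hFG⟩ : ∃ G : Ideal R, G.FG ∧ G ≤ J ∧ F₁ ≤ G ⊔ Ideal.span {x} := by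
          clear hfin₁
          induction F₁, hF₁ using Submodule.fg_induction with
          | singleton z =>
            obtain ⟨u, hu, w, hw, huw⟩ :=
              Submodule.mem_sup.1 (hFJ₁ (Submodule.mem_span_singleton_self z))
            refine ⟨Ideal.span {u}, Submodule.fg_span_singleton u,
              (Ideal.span_singleton_le_iff_mem _).2 hu,
              (Submodule.span_singleton_le_iff_mem _ _).2 ?_⟩
            rw [← huw]
            exact add_mem (Ideal.mem_sup_left (Ideal.mem_span_singleton_self u))
              (Ideal.mem_sup_right hw)
          | sup A B _ _ hA hB =>
            obtain ⟨G₁, hG₁, hGJ₁, hle₁⟩ := hA (le_sup_left.trans hFJ₁)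
            obtain ⟨G₂, hG₂, hGJ₂, hle₂⟩ := hB (le_sup_right.trans hFJ₁)
            exact ⟨G₁ ⊔ G₂, Submodule.FG.sup hG₁ hG₂, sup_le hGJ₁ hGJ₂, sup_le
              (hle₁.trans (sup_le_sup_right le_sup_left _))
              (hle₂.trans (sup_le_sup_right le_sup_right _))⟩
        refine ⟨G ⊔ F₂ * Ideal.span {x},
          Submodule.FG.sup hG (Submodule.FG.mul hF₂ (Submodule.fg_span_singleton x)),
          sup_le hGJ ?_, (hfin₁.union hfin₂).subset ?_⟩
        · rw [Ideal.mul_le]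
          intro y hy z hz
          obtain ⟨c, rfl⟩ := Ideal.mem_span_singleton.1 hz
          rw [← mul_assoc]
          exact J.mul_mem_right c (Ideal.mem_colon_span_singleton.1 (hFJ₂ hy))
        · rintro M ⟨hM, hle⟩
          by_cases hxM : x ∈ M
          · exact Or.inl ⟨hM, hFG.trans (sup_le (le_sup_left.trans hle)
              ((Ideal.span_singleton_le_iff_mem _).2 hxM))⟩
          · refine Or.inr ⟨hM, fun y hy => ?_⟩
            exact (hM.isPrime.mem_or_mem (hle (Ideal.mem_sup_right
              (Ideal.mul_mem_mul hy (Ideal.mem_span_singleton_self x))))).resolve_right hxM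
    have hall := hOka.forall_of_forall_prime' ?_ ?_
    · obtain ⟨F, -, hFa, hfin⟩ := hall (Ideal.span {a}) (Ideal.mem_span_singleton_self a)
      refine hfin.subset ?_
      rintro M ⟨hM, haM⟩
      exact ⟨hM, hFa.trans ((Ideal.span_singleton_le_iff_mem _).2 haM)⟩
    · intro C hC hchain J hJ hsup
      have haJ : a ∈ J := (Classical.not_imp.1 (hC hJ)).1
      obtain ⟨F, hF, hFC, hfin⟩ := hsup (le_sSup hJ haJ)
      obtain ⟨L, hL, hFL⟩ := (CompleteLattice.isCompactElement_iff_le_of_directed_sSup_le _ F).1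
        ((Submodule.fg_iff_compact F).1 hF) C ⟨J, hJ⟩ hchain.directedOn hFC
      exact ⟨L, hL, fun _ => ⟨F, hF, hFL, hfin⟩⟩
    · intro P hP haP
      obtain ⟨I, hI, hIv, hIP⟩ := h P hP fun h0 => ha (by simpa [h0] using haP)
      obtain ⟨F, hF, hFI, hIF⟩ := hI.exists_fg
      refine ⟨F, hF, hFI.trans hIP, Set.Subsingleton.finite ?_⟩
      rintro M ⟨hM, hFM⟩ N ⟨hN, hFN⟩
      exact hPvMD.eq_of_le_of_isValuationIdeal hI hIv hM hN
        (hIF.trans ((tcl_mono hFM).trans hM.isTIdeal.tcl_le))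
        (hIF.trans ((tcl_mono hFN).trans hN.isTIdeal.tcl_le))
  · obtain ⟨M, hM, hPM⟩ := exists_isMaximalTIdeal hPt hP.ne_top
    refine ⟨M, ⟨hM, hPM⟩, ?_⟩
    rintro N ⟨hN, hPN⟩
    obtain ⟨I, hI, hIv, hIP⟩ := h P hP hPt.ne_bot
    exact hPvMD.eq_of_le_of_isValuationIdeal hI hIv hN hM (hIP.trans hPN) (hIP.trans hPM)

end Treed

end TIdeals

namespace TIdeals

/-! ### `t`-ideals of `R[X]`, contents and `N_v`. -/

section PolynomialTIdeals

variable {R : Type*} [CommRing R] [IsDomain R]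

/-- A fraction `r / s` in the inverse of `F R[X]` equals `p / b₀` with constant denominator, so the
test is made coefficientwise. The case `F = ⊥` must go: over a field `vcl ⊥` is everything, over
`R[X]` it is zero. -/
theorem C_mem_vcl_map {F : Ideal R} (hF : F ≠ ⊥) {x : R} (hx : x ∈ vcl F) :
    (C x : R[X]) ∈ vcl (F.map C) := by
  intro r s hs h
  obtain ⟨b₀, hb₀F, hb₀⟩ := Submodule.exists_mem_ne_zero_of_ne_bot hF
  have hb₀' : (C b₀ : R[X]) ≠ 0 := C_ne_zero.2 hb₀
  obtain ⟨p, hp⟩ := h _ (Ideal.mem_map_of_mem C hb₀F)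
  have key : ∀ b ∈ F, C b₀ ∣ p * C b := by
    intro b hb
    obtain ⟨q, hq⟩ := h _ (Ideal.mem_map_of_mem C hb)
    exact ⟨q, mul_left_cancel₀ hs (by linear_combination C b₀ * hq - C b * hp)⟩
  have hpx : C b₀ ∣ p * C x := by
    rw [C_dvd_iff_dvd_coeff]
    intro n
    rw [coeff_mul_C]
    refine hx _ b₀ hb₀ fun b hb => ?_
    rw [← coeff_mul_C]
    exact (C_dvd_iff_dvd_coeff _ _).1 (key b hb) n
  obtain ⟨q, hq⟩ := hpx
  exact ⟨q, mul_left_cancel₀ hb₀' (by linear_combination C x * hp + s * hq)⟩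

theorem coeff_mem_vcl_of_mem_vcl_map {F : Ideal R} {f : R[X]} (hf : f ∈ vcl (F.map C)) (n : ℕ) :
    f.coeff n ∈ vcl F := by
  intro r s hs h
  have := hf (C r) (C s) (C_ne_zero.2 hs) fun g hg => by
    rw [C_dvd_iff_dvd_coeff]
    intro m
    rw [coeff_C_mul]
    exact h _ (Ideal.mem_map_C_iff.1 hg m)
  simpa using (C_dvd_iff_dvd_coeff _ _).1 this n

theorem le_map_contentIdeal (f : R[X]) : f ∈ f.contentIdeal.map C :=
  Ideal.mem_map_C_iff.2 f.coeff_mem_contentIdeal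

theorem contentIdeal_le_iff {I : Ideal R} {f : R[X]} : f.contentIdeal ≤ I ↔ f ∈ I.map C := by
  refine ⟨fun h => Ideal.map_mono h (le_map_contentIdeal f), fun h => ?_⟩
  rw [contentIdeal_def, Ideal.span_le]
  intro x hx
  obtain ⟨n, -, rfl⟩ := mem_coeffs_iff.1 hx
  exact Ideal.mem_map_C_iff.1 h n

theorem exists_fg_le_map_C {I : Ideal R} {F : Ideal R[X]} (hF : F.FG) (hFI : F ≤ I.map C) :
    ∃ G : Ideal R, G.FG ∧ G ≤ I ∧ F ≤ G.map C := by
  induction F, hF using Submodule.fg_induction with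
  | singleton f =>
    refine ⟨f.contentIdeal, f.contentIdeal_FG,
      contentIdeal_le_iff.2 (hFI (Submodule.mem_span_singleton_self f)), ?_⟩
    exact (Ideal.span_singleton_le_iff_mem _).2 (le_map_contentIdeal f)
  | sup F₁ F₂ _ _ h₁ h₂ =>
    obtain ⟨G₁, hG₁, hGI₁, hle₁⟩ := h₁ (le_sup_left.trans hFI)
    obtain ⟨G₂, hG₂, hGI₂, hle₂⟩ := h₂ (le_sup_right.trans hFI)
    exact ⟨G₁ ⊔ G₂, Submodule.FG.sup hG₁ hG₂, sup_le hGI₁ hGI₂,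
      sup_le (hle₁.trans (Ideal.map_mono le_sup_left)) (hle₂.trans (Ideal.map_mono le_sup_right))⟩

theorem map_C_ne_bot {I : Ideal R} (hI : I ≠ ⊥) : I.map (C : R →+* R[X]) ≠ ⊥ := by
  rwa [Ne, Ideal.map_eq_bot_iff_of_injective C_injective]

theorem comap_map_C (I : Ideal R) : (I.map (C : R →+* R[X])).comap C = I := by
  ext x
  rw [Ideal.mem_comap, Ideal.mem_map_C_iff]
  refine ⟨fun h => by simpa using h 0, fun h n => ?_⟩
  rw [coeff_C]
  split_ifs
  · exact h
  · exact I.zero_mem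

theorem map_C_ne_top {I : Ideal R} (hI : I ≠ ⊤) : I.map (C : R →+* R[X]) ≠ ⊤ := by
  intro h
  rw [← comap_map_C I, h, Ideal.comap_top] at hI
  exact hI rfl

theorem map_C_le_map_C {I J : Ideal R} : I.map (C : R →+* R[X]) ≤ J.map C ↔ I ≤ J := by
  refine ⟨fun h => ?_, fun h => Ideal.map_mono h⟩
  rw [← comap_map_C I, ← comap_map_C J]
  exact Ideal.comap_mono h

theorem IsTIdeal.map_C {I : Ideal R} (hI : IsTIdeal I) : IsTIdeal (I.map (C : R →+* R[X])) := by
  refine isTIdeal_iff.2 ⟨map_C_ne_bot hI.ne_bot, ?_⟩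
  rintro f ⟨F, hF, hFI, hf⟩
  obtain ⟨G, hG, hGI, hFG⟩ := exists_fg_le_map_C hF hFI
  refine Ideal.mem_map_C_iff.2 fun n => hI.tcl_le ⟨G, hG, hGI, ?_⟩
  exact coeff_mem_vcl_of_mem_vcl_map (vcl_mono hFG hf) n

theorem mem_tcl_iff_exists_ne_bot {I : Ideal R} (hI : I ≠ ⊥) {x : R} :
    x ∈ tcl I ↔ ∃ F : Ideal R, F.FG ∧ F ≠ ⊥ ∧ F ≤ I ∧ x ∈ vcl F := by
  constructor
  · rintro ⟨F, hF, hFI, hx⟩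
    obtain ⟨b, hbI, hb⟩ := Submodule.exists_mem_ne_zero_of_ne_bot hI
    refine ⟨F ⊔ Ideal.span {b}, Submodule.FG.sup hF (Submodule.fg_span_singleton b), fun h => ?_,
      sup_le hFI ((Ideal.span_singleton_le_iff_mem _).2 hbI), vcl_mono le_sup_left hx⟩
    exact hb (by simpa using (sup_eq_bot_iff.1 h).2)
  · rintro ⟨F, hF, -, hFI, hx⟩
    exact ⟨F, hF, hFI, hx⟩

theorem IsTIdeal.comap_C {N : Ideal R[X]} (hN : IsTIdeal N)
    (h : N.comap (C : R →+* R[X]) ≠ ⊥) : IsTIdeal (N.comap (C : R →+* R[X])) := by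
  refine isTIdeal_iff.2 ⟨h, fun x hx => ?_⟩
  obtain ⟨F, hF, hF0, hFN, hx⟩ := (mem_tcl_iff_exists_ne_bot h).1 hx
  exact hN.tcl_le ⟨F.map C, hF.map C, Ideal.map_le_iff_le_comap.2 hFN, C_mem_vcl_map hF0 hx⟩

theorem mem_Nv_iff {g : R[X]} : g ∈ Nv R ↔ g ≠ 0 ∧ (1 : R) ∈ vcl g.contentIdeal := by
  change g ≠ 0 ∧ vClosure (toFrac g.contentIdeal) = 1 ↔ _
  refine and_congr_right fun hg => ?_
  rw [vClosure_toFrac (by simpa using hg), FractionalIdeal.coeIdeal_eq_one, Ideal.one_eq_top,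
    Ideal.eq_top_iff_one]

/-- If `rg = sk` and `rp = sq`, then `qg = pk`. As `g ∈ N_v`, the constant `p` divides `q`, so `s`
divides `r`. -/
theorem one_mem_vcl_span_pair {g : R[X]} (hg : g ∈ Nv R) {p : R} (hp : p ≠ 0) :
    (1 : R[X]) ∈ vcl (Ideal.span {g, C p}) := by
  intro r s hs h
  obtain ⟨k, hk⟩ := h g (Ideal.subset_span (by simp))
  obtain ⟨q, hq⟩ := h (C p) (Ideal.subset_span (by simp))
  have hp' : (C p : R[X]) ≠ 0 := C_ne_zero.2 hp
  have h1 : C p ∣ q * g :=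
    ⟨k, mul_left_cancel₀ hs (by linear_combination C p * hk - g * hq)⟩
  obtain ⟨u, hu⟩ := C_dvd_of_C_dvd_mul hg hp h1
  exact ⟨u, mul_left_cancel₀ hp' (by linear_combination hq + s * hu)⟩

theorem IsTIdeal.comap_C_eq_bot {N : Ideal R[X]} (hN : IsTIdeal N) (hN' : N ≠ ⊤) {g : R[X]}
    (hg : g ∈ Nv R) (hgN : g ∈ N) : N.comap (C : R →+* R[X]) = ⊥ := by
  rw [eq_bot_iff]
  intro p hp
  by_contra hp0
  refine hN' ((Ideal.eq_top_iff_one _).2 (hN.tcl_le ⟨Ideal.span {g, C p},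
    Submodule.fg_span (by simp), ?_, one_mem_vcl_span_pair hg hp0⟩))
  rw [Ideal.span_le]
  rintro x (rfl | rfl)
  · exact hgN
  · exact hp

/-- Shifting `g` past the degree of `f` keeps the coefficients from overlapping, so one polynomial
carries both contents. -/
theorem contentIdeal_sup_le (f g : R[X]) :
    f.contentIdeal ⊔ g.contentIdeal ≤ (f + g * X ^ (f.natDegree + 1)).contentIdeal := by
  refine sup_le (contentIdeal_le_iff.2 (Ideal.mem_map_C_iff.2 fun n => ?_))
    (contentIdeal_le_iff.2 (Ideal.mem_map_C_iff.2 fun n => ?_))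
  · by_cases hn : n ≤ f.natDegree
    · have h : (f + g * X ^ (f.natDegree + 1)).coeff n = f.coeff n := by
        rw [coeff_add, coeff_mul_X_pow', if_neg (by omega), add_zero]
      exact h ▸ coeff_mem_contentIdeal _ n
    · rw [coeff_eq_zero_of_natDegree_lt (by omega)]
      exact zero_mem _
  · have h : (f + g * X ^ (f.natDegree + 1)).coeff (n + (f.natDegree + 1)) = g.coeff n := by
      rw [coeff_add, coeff_mul_X_pow, coeff_eq_zero_of_natDegree_lt (p := f) (by omega), zero_add]
    exact h ▸ coeff_mem_contentIdeal _ (n + (f.natDegree + 1))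

/-- The ideal generated by the coefficients of the elements of `N`. -/
def coeffIdeal (N : Ideal R[X]) : Ideal R := Ideal.span {x | ∃ f ∈ N, ∃ n, f.coeff n = x}

theorem exists_le_contentIdeal {N : Ideal R[X]} {F : Ideal R} (hF : F.FG) (hFN : F ≤ coeffIdeal N) :
    ∃ g ∈ N, F ≤ g.contentIdeal := by
  induction F, hF using Submodule.fg_induction with
  | singleton x =>
    have hx : x ∈ coeffIdeal N := hFN (Submodule.mem_span_singleton_self x)
    suffices ∃ g ∈ N, x ∈ g.contentIdeal by
      obtain ⟨g, hg, hxg⟩ := this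
      exact ⟨g, hg, (Ideal.span_singleton_le_iff_mem _).2 hxg⟩
    clear hFN
    induction hx using Submodule.span_induction with
    | mem x hx =>
      obtain ⟨f, hf, n, rfl⟩ := hx
      exact ⟨f, hf, f.coeff_mem_contentIdeal n⟩
    | zero => exact ⟨0, zero_mem _, zero_mem _⟩
    | add x y _ _ hx hy =>
      obtain ⟨f, hf, hxf⟩ := hx
      obtain ⟨g, hg, hyg⟩ := hy
      have hle := contentIdeal_sup_le f g
      exact ⟨_, add_mem hf (N.mul_mem_right _ hg), add_mem (hle (Ideal.mem_sup_left hxf)) (hle (Ideal.mem_sup_right hyg))⟩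
    | smul c x _ hx =>
      obtain ⟨f, hf, hxf⟩ := hx
      exact ⟨f, hf, Ideal.mul_mem_left _ c hxf⟩
  | sup F₁ F₂ _ _ h₁ h₂ =>
    obtain ⟨f, hf, hle₁⟩ := h₁ (le_sup_left.trans hFN)
    obtain ⟨g, hg, hle₂⟩ := h₂ (le_sup_right.trans hFN)
    exact ⟨_, add_mem hf (N.mul_mem_right _ hg),
      (sup_le_sup hle₁ hle₂).trans (contentIdeal_sup_le f g)⟩

/-- If the coefficients of `N` generated an ideal with `t`-closure `R`, finitely many would suffice,
and a single element of `N` has a content containing these; it would lie in `N_v`. -/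
theorem exists_le_map_C_of_forall_notMem_Nv {N : Ideal R[X]} (hN : N ≠ ⊥)
    (h : ∀ g ∈ N, g ∉ Nv R) : ∃ M : Ideal R, IsMaximalTIdeal M ∧ N ≤ M.map C := by
  have hle : N ≤ (coeffIdeal N).map C := fun f hf =>
    Ideal.mem_map_C_iff.2 fun n => Ideal.subset_span ⟨f, hf, n, rfl⟩
  have hne : coeffIdeal N ≠ ⊥ := by
    intro h0
    rw [h0, Ideal.map_bot] at hle
    exact hN (le_bot_iff.1 hle)
  obtain ⟨M, hM, hNM⟩ := exists_isMaximalTIdeal_of_tcl_ne_top hne fun htop => by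
    obtain ⟨F, hF, hF0, hFN, h1⟩ := (mem_tcl_iff_exists_ne_bot hne).1
      (show (1 : R) ∈ tcl (coeffIdeal N) from htop ▸ Submodule.mem_top)
    obtain ⟨g, hg, hFg⟩ := exists_le_contentIdeal hF hFN
    refine h g hg (mem_Nv_iff.2 ⟨?_, vcl_mono hFg h1⟩)
    rintro rfl
    rw [contentIdeal_zero, le_bot_iff] at hFg
    exact hF0 hFg
  exact ⟨M, hM, hle.trans (Ideal.map_mono hNM)⟩

theorem IsMaximalTIdeal.notMem_Nv {M : Ideal R} (hM : IsMaximalTIdeal M) {g : R[X]}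
    (hg : g ∈ M.map C) : g ∉ Nv R := by
  intro hgN
  exact hM.ne_top ((Ideal.eq_top_iff_one _).2 (hM.isTIdeal.tcl_le
    ⟨g.contentIdeal, g.contentIdeal_FG, contentIdeal_le_iff.2 hg, (mem_Nv_iff.1 hgN).2⟩))

theorem IsMaximalTIdeal.map_C {M : Ideal R} (hM : IsMaximalTIdeal M) :
    IsMaximalTIdeal (M.map (C : R →+* R[X])) := by
  refine ⟨⟨hM.isTIdeal.map_C, map_C_ne_top hM.ne_top⟩, ?_⟩
  rintro N ⟨hN, hN'⟩ hMN
  have hcomap : M ≤ N.comap C := Ideal.map_le_iff_le_comap.1 hMN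
  obtain ⟨M', hM', hNM'⟩ := exists_le_map_C_of_forall_notMem_Nv hN.ne_bot fun g hg hgNv =>
    hM.isTIdeal.ne_bot (le_bot_iff.1 (hN.comap_C_eq_bot hN' hgNv hg ▸ hcomap))
  have hMM' := hM.eq_of_le hM'.isTIdeal hM'.ne_top (map_C_le_map_C.1 (hMN.trans hNM'))
  exact hMM' ▸ hNM'

theorem IsMaximalTIdeal.eq_map_C {N : Ideal R[X]} (hN : IsMaximalTIdeal N)
    (h : N.comap (C : R →+* R[X]) ≠ ⊥) : ∃ M : Ideal R, IsMaximalTIdeal M ∧ N = M.map C := by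
  obtain ⟨M, hM, hNM⟩ := exists_le_map_C_of_forall_notMem_Nv hN.isTIdeal.ne_bot
    fun g hg hgNv => h (hN.isTIdeal.comap_C_eq_bot hN.ne_top hgNv hg)
  exact ⟨M, hM, hN.eq_of_le hM.map_C.isTIdeal hM.map_C.ne_top hNM⟩

end PolynomialTIdeals

/-! ### Uppers to zero, by comparison with `K[X]`. -/

section UppersToZero

variable {R : Type*} [CommRing R] [IsDomain R]

theorem exists_C_mul_eq_map (p : (FractionRing R)[X]) :
    ∃ c : R, c ≠ 0 ∧ ∃ q : R[X], q.map (algebraMap R (FractionRing R)) =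
      C (algebraMap R (FractionRing R) c) * p := by
  obtain ⟨c, hc, h⟩ := IsLocalization.integerNormalization_spec R⁰ p
  refine ⟨c, nonZeroDivisors.ne_zero hc, _, h.trans ?_⟩
  rw [← Polynomial.algebraMap_eq, ← Algebra.smul_def, algebraMap_smul]

/-- The localization at `Q` is one of the PID `K[X]`. Dividing `f`, `g` by their gcd there and
clearing denominators gives `f₁`, `g₁` with a nonzero constant combination, so they are not both in
`Q`. -/
theorem isValuationAt_of_comap_C_eq_bot {Q : Ideal R[X]} [hQ : Q.IsPrime]
    (h : Q.comap (C : R →+* R[X]) = ⊥) : IsValuationAt Q := by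
  classical
  intro f g
  by_cases hf : f = 0
  · exact Or.inr ⟨1, Q.one_notMem, by simp [hf]⟩
  let φ := mapRingHom (algebraMap R (FractionRing R))
  have hφ : Function.Injective φ := map_injective _ (IsFractionRing.injective R (FractionRing R))
  have hφC : ∀ c, φ (C c) = C (algebraMap R (FractionRing R) c) := fun c => by simp [φ]
  have hCQ : ∀ c : R, c ≠ 0 → C c ∉ Q := fun c hc hcQ => hc (by
    have : c ∈ Q.comap (C : R →+* R[X]) := hcQ
    rwa [h] at this)
  obtain ⟨F, hF⟩ := EuclideanDomain.gcd_dvd_left (φ f) (φ g)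
  obtain ⟨G, hG⟩ := EuclideanDomain.gcd_dvd_right (φ f) (φ g)
  set d := EuclideanDomain.gcd (φ f) (φ g) with hd
  have hd0 : d ≠ 0 := by
    intro h0
    rw [h0, zero_mul] at hF
    exact hf (hφ (by rw [hF, map_zero]))
  obtain ⟨A, B, hAB⟩ : ∃ A B, A * F + B * G = 1 := by
    refine ⟨EuclideanDomain.gcdA (φ f) (φ g), EuclideanDomain.gcdB (φ f) (φ g),
      mul_left_cancel₀ hd0 ?_⟩
    have := EuclideanDomain.gcd_eq_gcd_ab (φ f) (φ g)
    rw [← hd] at this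
    linear_combination (-EuclideanDomain.gcdA (φ f) (φ g)) * hF -
      EuclideanDomain.gcdB (φ f) (φ g) * hG - this
  obtain ⟨c₁, hc₁, f₁, hf₁⟩ := exists_C_mul_eq_map F
  obtain ⟨c₂, hc₂, g₁, hg₁⟩ := exists_C_mul_eq_map G
  obtain ⟨c₃, hc₃, a, ha⟩ := exists_C_mul_eq_map A
  obtain ⟨c₄, hc₄, b, hb⟩ := exists_C_mul_eq_map B
  change φ f₁ = _ at hf₁
  change φ g₁ = _ at hg₁
  change φ a = _ at ha
  change φ b = _ at hb
  rw [← hφC] at hf₁ hg₁ ha hb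
  have hcop : C (c₂ * c₄) * (a * f₁) + C (c₁ * c₃) * (b * g₁) = C (c₁ * c₂ * c₃ * c₄) := by
    apply hφ
    simp only [map_mul, map_add, hf₁, hg₁, ha, hb]
    linear_combination (φ (C c₁) * φ (C c₂) * φ (C c₃) * φ (C c₄)) * hAB
  have hfg : C c₂ * f₁ * g = C c₁ * g₁ * f := by
    apply hφ
    simp only [map_mul, hf₁, hg₁]
    rw [hF, hG]
    ring
  by_cases hf₁Q : f₁ ∈ Q
  · have hg₁Q : g₁ ∉ Q := by
      intro hg₁Q
      refine hCQ (c₁ * c₂ * c₃ * c₄) (by simp [*]) ?_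
      rw [← hcop]
      exact add_mem (Q.mul_mem_left _ (Q.mul_mem_left _ hf₁Q))
        (Q.mul_mem_left _ (Q.mul_mem_left _ hg₁Q))
    exact Or.inr ⟨C c₁ * g₁, hQ.mul_notMem (hCQ _ hc₁) hg₁Q, C c₂ * f₁,
      by linear_combination -hfg⟩
  · exact Or.inl ⟨C c₂ * f₁, hQ.mul_notMem (hCQ _ hc₂) hf₁Q, C c₁ * g₁, by
      linear_combination hfg⟩

attribute [local instance] Polynomial.algebra in
theorem map_isPrime_and_comap_map {Q : Ideal R[X]} (hQ : Q.IsPrime)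
    (h : Q.comap (C : R →+* R[X]) = ⊥) :
    (Q.map (mapRingHom (algebraMap R (FractionRing R)))).IsPrime ∧
      (Q.map (mapRingHom (algebraMap R (FractionRing R)))).comap
        (mapRingHom (algebraMap R (FractionRing R))) = Q := by
  have := Polynomial.isLocalization R⁰ (FractionRing R)
  have hdisj : Disjoint ((R⁰.map (C : R →+* R[X]) : Submonoid R[X]) : Set R[X]) (Q : Set R[X]) := by
    rw [Set.disjoint_left]
    rintro _ ⟨c, hc, rfl⟩ hcQ
    have hcQ : c ∈ Q.comap (C : R →+* R[X]) := hcQ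
    rw [h] at hcQ
    exact nonZeroDivisors.ne_zero hc hcQ
  exact ⟨IsLocalization.isPrime_of_isPrime_disjoint (R⁰.map C) (FractionRing R)[X] Q hQ hdisj,
    IsLocalization.under_map_of_isPrime_disjoint (R⁰.map C) (FractionRing R)[X] hQ hdisj⟩

theorem eq_of_le_of_comap_C_eq_bot {P Q : Ideal R[X]} (hP : P.IsPrime) (hQ : Q.IsPrime)
    (hP0 : P ≠ ⊥) (h : Q.comap (C : R →+* R[X]) = ⊥) (hPQ : P ≤ Q) : P = Q := by
  have hP' : P.comap (C : R →+* R[X]) = ⊥ := le_bot_iff.1 (h ▸ Ideal.comap_mono hPQ)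
  obtain ⟨h₁, h₂⟩ := map_isPrime_and_comap_map hP hP'
  obtain ⟨h₃, h₄⟩ := map_isPrime_and_comap_map hQ h
  have hmax := h₁.isMaximal (by
    rwa [Ne, Ideal.map_eq_bot_iff_of_injective
      (map_injective _ (IsFractionRing.injective R (FractionRing R)))])
  rw [← h₂, ← h₄, hmax.eq_of_le h₃.ne_top (Ideal.map_mono hPQ)]

theorem isTIdeal_of_comap_C_eq_bot {Q : Ideal R[X]} (hQ : Q.IsPrime) (hQ0 : Q ≠ ⊥)
    (h : Q.comap (C : R →+* R[X]) = ⊥) : IsTIdeal Q := by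
  obtain ⟨P, hPQ, hP, hPt⟩ := exists_isTIdeal_le hQ hQ0
  rwa [← eq_of_le_of_comap_C_eq_bot hP hQ hPt.ne_bot h hPQ]

theorem finite_setOf_comap_C_eq_bot {f : R[X]} (hf : f ≠ 0) :
    {Q : Ideal R[X] | Q.IsPrime ∧ Q.comap (C : R →+* R[X]) = ⊥ ∧ f ∈ Q}.Finite := by
  let φ := mapRingHom (algebraMap R (FractionRing R))
  have hφ : Function.Injective φ := map_injective _ (IsFractionRing.injective R (FractionRing R))
  refine Set.Finite.of_finite_image (f := Ideal.map φ)
    ((Ideal.finite_minimalPrimes_of_isNoetherianRing _ (Ideal.span {φ f})).subset ?_) ?_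
  · rintro _ ⟨Q, ⟨hQ, hQ0, hfQ⟩, rfl⟩
    have hp := (map_isPrime_and_comap_map hQ hQ0).1
    refine ⟨⟨hp, (Ideal.span_singleton_le_iff_mem _).2 (Ideal.mem_map_of_mem φ hfQ)⟩, ?_⟩
    rintro P ⟨hP, hfP⟩ hPQ
    have hmax := hP.isMaximal (by
      rintro rfl
      rw [le_bot_iff, Ideal.span_singleton_eq_bot] at hfP
      exact hf (hφ (by rw [hfP, map_zero])))
    exact (hmax.eq_of_le hp.ne_top hPQ).ge
  · rintro P ⟨hP, hP0, -⟩ Q ⟨hQ, hQ0, -⟩ hPQ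
    rw [← (map_isPrime_and_comap_map hP hP0).2, ← (map_isPrime_and_comap_map hQ hQ0).2]
    exact congrArg (Ideal.comap φ) hPQ

end UppersToZero

end TIdeals

namespace TIdeals

/-! ### The P`v`MD and Krull type properties under polynomial extension. -/

section PolynomialPvMD

variable {R : Type*} [CommRing R] [IsDomain R]

theorem C_mem_map_C_iff {I : Ideal R} {x : R} : (C x : R[X]) ∈ I.map C ↔ x ∈ I := by
  rw [← Ideal.mem_comap, comap_map_C]

theorem IsValuationAt.exists_content_factor {M : Ideal R} [M.IsPrime] (hM : IsValuationAt M)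
    {h : R[X]} (h0 : h ≠ 0) : ∃ a ∈ h.contentIdeal, a ≠ 0 ∧ ∃ x, x ∉ M ∧
      (∀ b ∈ h.contentIdeal, a ∣ x * b) ∧ ∃ h', C x * h = C a * h' ∧ h' ∉ M.map C := by
  obtain ⟨a, hah, ha, x, hx, hxa⟩ := hM.exists_generator h.contentIdeal_FG (by simpa using h0)
  obtain ⟨h', hh'⟩ : C a ∣ C x * h := by
    rw [C_dvd_iff_dvd_coeff]
    intro n
    rw [coeff_C_mul]
    exact hxa _ (h.coeff_mem_contentIdeal n)
  refine ⟨a, hah, ha, x, hx, hxa, h', hh', fun hh'M => ?_⟩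
  -- If `h'` were in `M[X]`, then `x c(h) ⊆ aM`; as `a ∈ c(h)`, this gives `x ∈ M`.
  have hle : h.contentIdeal ≤ (Ideal.span {a} * M).colon (Ideal.span {x}) := by
    rw [contentIdeal_le_iff, Ideal.mem_map_C_iff]
    intro n
    rw [Ideal.mem_colon_span_singleton, Ideal.mem_span_singleton_mul]
    refine ⟨h'.coeff n, Ideal.mem_map_C_iff.1 hh'M n, ?_⟩
    rw [← coeff_C_mul, ← hh', coeff_C_mul, mul_comm]
  obtain ⟨m, hm, hma⟩ := Ideal.mem_span_singleton_mul.1 (Ideal.mem_colon_span_singleton.1 (hle hah))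
  exact hx (mul_left_cancel₀ ha hma ▸ hm)

/-- Gauss's lemma in local form: at `M[X]`, `h` is a local generator of its content times a unit,
and that generator divides `f`. -/
theorem IsValuationAt.dvdAt_map_C {M : Ideal R} [hMp : M.IsPrime] (hM : IsValuationAt M)
    {f h : R[X]} (h0 : h ≠ 0) {y : R} (hy : y ∉ M)
    (hfh : ∀ b ∈ f.contentIdeal, y * b ∈ h.contentIdeal) : DvdAt (M.map C) h f := by
  have := Ideal.isPrime_map_C_of_isPrime (P := M)
  obtain ⟨a, hah, ha, x, hx, hxa, h', hh', hh'M⟩ := hM.exists_content_factor h0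
  obtain ⟨f', hf'⟩ : C a ∣ C (x * y) * f := by
    rw [C_dvd_iff_dvd_coeff]
    intro n
    rw [coeff_C_mul, mul_assoc]
    exact hxa _ (hfh _ (f.coeff_mem_contentIdeal n))
  rw [C_mul] at hf'
  exact ⟨h' * C y, this.mul_notMem hh'M (fun h => hy (C_mem_map_C_iff.1 h)), f',
    mul_left_cancel₀ (C_ne_zero.2 ha) (by linear_combination (-C y * f) * hh' + h * hf')⟩

theorem IsValuationAt.map_C {M : Ideal R} [hMp : M.IsPrime] (hM : IsValuationAt M) :
    IsValuationAt (M.map (C : R →+* R[X])) := by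
  have hp := Ideal.isPrime_map_C_of_isPrime (P := M)
  have key : ∀ {f g : R[X]} {a b x : R}, f ≠ 0 → a ∈ f.contentIdeal → x ∉ M →
      (∀ c ∈ g.contentIdeal, b ∣ x * c) → DvdAt M a b → DvdAt (M.map C) f g := by
    rintro f g a b x hf ha hx hb ⟨u, hu, v, huv⟩
    refine hM.dvdAt_map_C hf (hMp.mul_notMem hu hx) fun c hc => ?_
    obtain ⟨e, he⟩ := hb c hc
    have : u * x * c = v * e * a := by linear_combination u * he + e * huv
    rw [this]
    exact Ideal.mul_mem_left _ _ ha
  intro f g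
  by_cases hf : f = 0
  · exact Or.inr ⟨1, Ideal.one_notMem _, by simp [hf]⟩
  by_cases hg : g = 0
  · exact Or.inl ⟨1, Ideal.one_notMem _, by simp [hg]⟩
  obtain ⟨a, haf, -, x, hx, hxa, -⟩ := hM.exists_content_factor hf
  obtain ⟨b, hbg, -, y, hy, hyb, -⟩ := hM.exists_content_factor hg
  exact (hM a b).imp (key hf haf hy hyb) (key hg hbg hx hxa)

theorem IsPvMD.polynomial (hR : IsPvMD R) : IsPvMD R[X] := by
  rw [isPvMD_iff] at hR ⊢
  intro N hN
  by_cases h : N.comap (C : R →+* R[X]) = ⊥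
  · have := hN.isPrime
    exact isValuationAt_of_comap_C_eq_bot h
  · obtain ⟨M, hM, rfl⟩ := hN.eq_map_C h
    have := hM.isPrime
    exact (hR M hM).map_C

/-- Otherwise `Q ≤ M[X]` for some `M`. Removing the local content of a nonzero `f ∈ Q` leaves an
element of `Q` outside `M[X]`. -/
theorem IsPvMD.exists_mem_Nv (hR : IsPvMD R) {Q : Ideal R[X]} (hQ : Q.IsPrime) (hQ0 : Q ≠ ⊥)
    (h : Q.comap (C : R →+* R[X]) = ⊥) : ∃ g ∈ Q, g ∈ Nv R := by
  by_contra! hcon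
  obtain ⟨M, hM, hQM⟩ := exists_le_map_C_of_forall_notMem_Nv hQ0 hcon
  have hMp := hM.isPrime
  obtain ⟨f, hfQ, hf⟩ := Submodule.exists_mem_ne_zero_of_ne_bot hQ0
  obtain ⟨a, -, ha, x, -, -, f', hff', hf'M⟩ :=
    (isPvMD_iff.1 hR M hM).exists_content_factor hf
  have haQ : C a ∉ Q := by
    intro haQ
    have : a ∈ Q.comap (C : R →+* R[X]) := haQ
    rw [h] at this
    exact ha this
  exact hf'M (hQM ((hQ.mem_or_mem (hff' ▸ Q.mul_mem_left _ hfQ)).resolve_left haQ))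

theorem IsPvMD.isUMT (hR : IsPvMD R) : IsUMT R := by
  intro Q hQ hQ0 h
  refine ⟨⟨isTIdeal_of_comap_C_eq_bot hQ hQ0 h, hQ.ne_top⟩, ?_⟩
  rintro N ⟨hN, hN'⟩ hQN
  obtain ⟨g, hgQ, hg⟩ := hR.exists_mem_Nv hQ hQ0 h
  obtain ⟨M, hM, hNM⟩ := exists_isMaximalTIdeal hN hN'
  have hM0 := hM.isTIdeal.comap_C_eq_bot hM.ne_top hg (hNM (hQN hgQ))
  rwa [eq_of_le_of_comap_C_eq_bot hQ hM.isPrime hQ0 hM0 (hQN.trans hNM)]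

theorem not_isUnit_coeff_of_mem_map_C {f : R[X]} {M : Ideal R} (hM : M ≠ ⊤) (hf : f ∈ M.map C) (n : ℕ) :
    ¬ IsUnit (f.coeff n) := fun hu =>
  hM (Ideal.eq_top_of_isUnit_mem _ (Ideal.mem_map_C_iff.1 hf n) hu)

theorem IsWeaklyMatlis.finite_setOf_mem_map_C (hR : IsWeaklyMatlis R) {f : R[X]} (hf : f ≠ 0) :
    {M : Ideal R | IsMaximalTIdeal M ∧ f ∈ M.map C}.Finite := by
  by_cases hu : IsUnit f.leadingCoeff
  · refine Set.finite_empty.subset ?_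
    rintro M ⟨hM, hfM⟩
    exact not_isUnit_coeff_of_mem_map_C hM.ne_top hfM _ hu
  · refine (hR.1 _ (leadingCoeff_ne_zero.2 hf) hu).subset ?_
    rintro M ⟨hM, hfM⟩
    exact ⟨hM, Ideal.mem_map_C_iff.1 hfM _⟩

theorem IsWeaklyMatlis.eq_of_le_map_C (hR : IsWeaklyMatlis R) (hUMT : IsUMT R) {Q : Ideal R[X]}
    (hQ : Q.IsPrime) (hQ0 : Q ≠ ⊥) {M N : Ideal R} (hM : IsMaximalTIdeal M)
    (hN : IsMaximalTIdeal N) (hQM : Q ≤ M.map C) (hQN : Q ≤ N.map C) : M = N := by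
  by_cases h : Q.comap (C : R →+* R[X]) = ⊥
  · have hmax := hUMT Q hQ hQ0 h
    rw [hmax.eq_of_le hM.map_C.isTIdeal hM.map_C.ne_top hQM, comap_map_C] at h
    exact absurd h hM.isTIdeal.ne_bot
  · refine hR.eq_of_le (hQ.comap C) h hM hN ?_ ?_
    · rw [← comap_map_C M]
      exact Ideal.comap_mono hQM
    · rw [← comap_map_C N]
      exact Ideal.comap_mono hQN

theorem IsIndependentRingOfKrullType.polynomial (hR : IsIndependentRingOfKrullType R) :
    IsIndependentRingOfKrullType R[X] := by
  refine ⟨⟨fun f hf _ => ?_, fun Q hQ hQt => ?_⟩, hR.2.polynomial⟩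
  · refine ((finite_setOf_comap_C_eq_bot hf).union
      ((hR.1.finite_setOf_mem_map_C hf).image (Ideal.map C))).subset ?_
    rintro N ⟨hN, hfN⟩
    by_cases h : N.comap (C : R →+* R[X]) = ⊥
    · exact Or.inl ⟨hN.isPrime, h, hfN⟩
    · obtain ⟨M, hM, rfl⟩ := hN.eq_map_C h
      exact Or.inr ⟨M, ⟨hM, hfN⟩, rfl⟩
  · obtain ⟨N, hN, hQN⟩ := exists_isMaximalTIdeal hQt hQ.ne_top
    refine ⟨N, ⟨hN, hQN⟩, ?_⟩
    rintro N' ⟨hN', hQN'⟩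
    have hUMT := hR.2.isUMT
    have aux : ∀ {N N' : Ideal R[X]}, IsMaximalTIdeal N → IsMaximalTIdeal N' → Q ≤ N → Q ≤ N' →
        N.comap (C : R →+* R[X]) = ⊥ → N = N' := by
      intro N N' hN hN' hQN hQN' h
      have := eq_of_le_of_comap_C_eq_bot hQ hN.isPrime hQt.ne_bot h hQN
      subst this
      exact hN.eq_of_le hN'.isTIdeal hN'.ne_top hQN'
    by_cases h : N.comap (C : R →+* R[X]) = ⊥
    · exact (aux hN hN' hQN hQN' h).symm
    by_cases h' : N'.comap (C : R →+* R[X]) = ⊥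
    · exact aux hN' hN hQN' hQN h'
    obtain ⟨M, hM, rfl⟩ := hN.eq_map_C h
    obtain ⟨M', hM', rfl⟩ := hN'.eq_map_C h'
    rw [hR.1.eq_of_le_map_C hUMT hQ hQt.ne_bot hM hM' hQN hQN']

theorem IsValuationAt.of_map_C {M : Ideal R} (hM : IsValuationAt (M.map (C : R →+* R[X]))) :
    IsValuationAt M := by
  have key : ∀ {b c : R}, DvdAt (M.map (C : R →+* R[X])) (C b) (C c) → DvdAt M b c := by
    rintro b c ⟨s, hs, hd⟩
    rw [Ideal.mem_map_C_iff, not_forall] at hs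
    obtain ⟨n, hn⟩ := hs
    refine ⟨s.coeff n, hn, ?_⟩
    rw [← coeff_mul_C]
    exact (C_dvd_iff_dvd_coeff _ _).1 hd n
  exact fun b c => (hM (C b) (C c)).imp key key

theorem IsIndependentRingOfKrullType.of_polynomial (hR : IsIndependentRingOfKrullType R[X]) :
    IsIndependentRingOfKrullType R := by
  refine ⟨⟨fun a ha hu => ?_, fun P hP hPt => ?_⟩, isPvMD_iff.2 fun M hM =>
    (isPvMD_iff.1 hR.2 _ hM.map_C).of_map_C⟩
  · have hfin := hR.1.1 (C a) (C_ne_zero.2 ha) (by rwa [isUnit_C])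
    refine Set.Finite.of_finite_image (f := Ideal.map (C : R →+* R[X])) (hfin.subset ?_) ?_
    · rintro _ ⟨M, ⟨hM, haM⟩, rfl⟩
      exact ⟨hM.map_C, Ideal.mem_map_of_mem C haM⟩
    · intro M _ N _ h
      rw [← comap_map_C M, ← comap_map_C N]
      exact congrArg (Ideal.comap C) h
  · obtain ⟨M, hM, hPM⟩ := exists_isMaximalTIdeal hPt hP.ne_top
    refine ⟨M, ⟨hM, hPM⟩, ?_⟩
    rintro N ⟨hN, hPN⟩
    have := hR.1.eq_of_le Ideal.isPrime_map_C_of_isPrime (map_C_ne_bot hPt.ne_bot) hN.map_C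
      hM.map_C (Ideal.map_mono hPN) (Ideal.map_mono hPM)
    rw [← comap_map_C M, ← comap_map_C N, this]

end PolynomialPvMD

/-! ### Primes of `R[X]` over UMT-domains, and treedness of `R[X]`. -/

section UMT

variable {R : Type*} [CommRing R] [IsDomain R]

/-- Induction on the number of terms of `h`: `q` divides the product of the leading coefficients, so
after multiplication by that of `f` the top term of `h` can be dropped. -/
theorem C_dvd_C_leadingCoeff_pow_mul {f : R[X]} {q : R} (n : ℕ) :
    ∀ h : R[X], h.support.card ≤ n → C q ∣ f * h → ∃ m : ℕ, C q ∣ C f.leadingCoeff ^ m * h := by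
  induction n with
  | zero =>
    intro h hn _
    have : h = 0 := by simpa using hn
    exact ⟨0, by simp [this]⟩
  | succ n ih =>
    intro h hn hfh
    by_cases h0 : h = 0
    · exact ⟨0, by simp [h0]⟩
    have hlead : q ∣ f.leadingCoeff * h.leadingCoeff := by
      have := (C_dvd_iff_dvd_coeff _ _).1 hfh (f.natDegree + h.natDegree)
      rwa [coeff_mul_degree_add_degree] at this
    have hmon : C q ∣ C f.leadingCoeff * monomial h.natDegree h.leadingCoeff := by
      rw [C_mul_monomial, ← C_mul_X_pow_eq_monomial]
      exact (map_dvd C hlead).mul_right _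
    have hsplit := h.eraseLead_add_monomial_natDegree_leadingCoeff
    have hcard : (C f.leadingCoeff * h.eraseLead).support.card ≤ n := by
      have h1 := eraseLead_support_card_lt h0
      have h2 : (C f.leadingCoeff * h.eraseLead).support ⊆ h.eraseLead.support := by
        intro i hi
        rw [mem_support_iff, coeff_C_mul] at hi
        exact mem_support_iff.2 (right_ne_zero_of_mul hi)
      have h3 := Finset.card_le_card h2
      omega
    obtain ⟨m, hm⟩ := ih _ hcard (by
      have h1 : f * (C f.leadingCoeff * h.eraseLead) = C f.leadingCoeff * (f * h) -
          f * (C f.leadingCoeff * monomial h.natDegree h.leadingCoeff) := by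
        linear_combination (C f.leadingCoeff * f) * hsplit
      rw [h1]
      exact dvd_sub (hfh.mul_left _) (hmon.mul_left _))
    refine ⟨m + 1, ?_⟩
    have h1 : C f.leadingCoeff ^ (m + 1) * h = C f.leadingCoeff ^ m *
        (C f.leadingCoeff * h.eraseLead) + C f.leadingCoeff ^ m *
          (C f.leadingCoeff * monomial h.natDegree h.leadingCoeff) := by
      linear_combination (-C f.leadingCoeff ^ (m + 1)) * hsplit
    rw [h1]
    exact dvd_add hm (hmon.mul_left _)

theorem exists_leadingCoeff_notMem {P : Ideal R} {Q : Ideal R[X]} (hPQ : P.map C ≤ Q) (n : ℕ) :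
    ∀ f : R[X], f.support.card ≤ n → f ∈ Q → f ∉ P.map C →
      ∃ g ∈ Q, g.leadingCoeff ∉ P := by
  induction n with
  | zero =>
    intro f hn _ hfP
    have : f = 0 := by simpa using hn
    exact absurd (this ▸ zero_mem _) hfP
  | succ n ih =>
    intro f hn hfQ hfP
    by_cases hl : f.leadingCoeff ∈ P
    · have hf0 : f ≠ 0 := fun h0 => hfP (h0 ▸ zero_mem _)
      have hmon : monomial f.natDegree f.leadingCoeff ∈ P.map (C : R →+* R[X]) := by
        rw [← C_mul_X_pow_eq_monomial]
        exact Ideal.mul_mem_right _ _ (Ideal.mem_map_of_mem C hl)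
      have hsplit := f.eraseLead_add_monomial_natDegree_leadingCoeff
      have hlt := eraseLead_support_card_lt hf0
      refine ih f.eraseLead (by omega) ?_ fun h => ?_
      · exact (Submodule.add_mem_iff_left Q (hPQ hmon)).1 (hsplit.symm ▸ hfQ)
      · exact hfP (hsplit ▸ add_mem h hmon)
    · exact ⟨f, hfQ, hl⟩

/-- A prime of `R[X]` that is not extended from `R` contains an upper to zero. -/
theorem exists_comap_C_eq_bot_le {Q : Ideal R[X]} (hQ : Q.IsPrime)
    (h : Q ≠ (Q.comap (C : R →+* R[X])).map C) :
    ∃ P ≤ Q, P.IsPrime ∧ P ≠ ⊥ ∧ P.comap (C : R →+* R[X]) = ⊥ := by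
  have hle : (Q.comap (C : R →+* R[X])).map C ≤ Q := Ideal.map_comap_le
  obtain ⟨f₀, hf₀Q, hf₀⟩ := SetLike.not_le_iff_exists.1 fun h' => h (le_antisymm h' hle)
  obtain ⟨f, hfQ, hf⟩ := exists_leadingCoeff_notMem hle _ f₀ le_rfl hf₀Q hf₀
  obtain ⟨P, hP, hPQ⟩ := Ideal.exists_minimalPrimes_le
    ((Ideal.span_singleton_le_iff_mem _).2 hfQ)
  have hPp : P.IsPrime := hP.1.1
  have hfP : f ∈ P := hP.1.2 (Ideal.mem_span_singleton_self f)
  have hf0 : f ≠ 0 := by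
    rintro rfl
    exact hf (by simp)
  refine ⟨P, hPQ, hPp, fun h0 => hf0 (by simpa [h0] using hfP), le_bot_iff.1 fun p hp => ?_⟩
  by_contra hp0
  -- A nonzero constant `p` in `P` gives `s p^n = f k` with `s ∉ P`. A power of the leading
  -- coefficient of `f` makes `k` divisible by `p^n`; cancelling puts that power times `s` into `P`,
  -- against the choice of `f`.
  obtain ⟨s, hs, n, k, hk⟩ := exists_dvd_mul_pow (P := P) (b := f) (c := C p)
    fun Q' hQ' hQP' hfQ' => hP.2 ⟨hQ', (Ideal.span_singleton_le_iff_mem _).2 hfQ'⟩ hQP' hp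
  rw [← C_pow] at hk
  obtain ⟨m, k', hk'⟩ := C_dvd_C_leadingCoeff_pow_mul (f := f) (q := p ^ n) _ k le_rfl
    ⟨s, by rw [← hk, mul_comm]⟩
  have hmem : C f.leadingCoeff ^ m * s ∈ P := by
    have : C f.leadingCoeff ^ m * s = k' * f :=
      mul_left_cancel₀ (C_ne_zero.2 (pow_ne_zero n hp0))
        (by linear_combination C f.leadingCoeff ^ m * hk + f * hk')
    rw [this]
    exact P.mul_mem_left _ hfP
  exact hf (hPQ (hPp.mem_of_pow_mem m ((hPp.mem_or_mem hmem).resolve_right hs)))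

theorem IsUMT.eq_map_C (hR : IsUMT R) {Q N : Ideal R[X]} (hQ : Q.IsPrime) (hN : IsTIdeal N)
    (hN' : N ≠ ⊤) (hQN : Q ≤ N) (h : N.comap (C : R →+* R[X]) ≠ ⊥) :
    Q = (Q.comap (C : R →+* R[X])).map C := by
  by_contra hne
  obtain ⟨P, hPQ, hP, hP0, hPC⟩ := exists_comap_C_eq_bot_le hQ hne
  have := (hR P hP hP0 hPC).eq_of_le hN hN' (hPQ.trans hQN)
  exact h (this ▸ hPC)

theorem IsTTreed.polynomial (hR : IsTTreed R) (hUMT : IsUMT R) : IsTTreed R[X] := by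
  intro P Q M hP hQ hM hPt hQt hMt hPM hQM
  by_cases hP0 : P.comap (C : R →+* R[X]) = ⊥
  · have := (hUMT P hP hPt.ne_bot hP0).eq_of_le hMt hM.ne_top hPM
    exact Or.inr (this ▸ hQM)
  by_cases hQ0 : Q.comap (C : R →+* R[X]) = ⊥
  · have := (hUMT Q hQ hQt.ne_bot hQ0).eq_of_le hMt hM.ne_top hQM
    exact Or.inl (this ▸ hPM)
  have hM0 : M.comap (C : R →+* R[X]) ≠ ⊥ := fun h0 =>
    hP0 (le_bot_iff.1 (h0 ▸ Ideal.comap_mono hPM))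
  rw [hUMT.eq_map_C hP hMt hM.ne_top hPM hM0, hUMT.eq_map_C hQ hMt hM.ne_top hQM hM0,
    map_C_le_map_C, map_C_le_map_C]
  exact hR _ _ _ (hP.comap C) (hQ.comap C) (hM.comap C) (hPt.comap_C hP0) (hQt.comap_C hQ0)
    (hMt.comap_C hM0) (Ideal.comap_mono hPM) (Ideal.comap_mono hQM)

end UMT

end TIdeals

namespace TIdeals

/-! ### Domains whose nonzero maximal ideals are `t`-ideals, and valuation factorizations. -/

section MaximalIdealsAreTIdeals

variable {S : Type*} [CommRing S] [IsDomain S]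

theorem isMaximalTIdeal_iff_isMaximal (hS : ∀ M : Ideal S, M.IsMaximal → M ≠ ⊥ → IsTIdeal M)
    {M : Ideal S} : IsMaximalTIdeal M ↔ M.IsMaximal ∧ M ≠ ⊥ := by
  constructor
  · intro hM
    obtain ⟨N, hN, hMN⟩ := Ideal.exists_le_maximal M hM.ne_top
    have hN0 : N ≠ ⊥ := fun h0 => hM.isTIdeal.ne_bot (le_bot_iff.1 (h0 ▸ hMN))
    rw [hM.eq_of_le (hS N hN hN0) hN.ne_top hMN]
    exact ⟨hN, hN0⟩
  · rintro ⟨hM, hM0⟩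
    refine ⟨⟨hS M hM hM0, hM.ne_top⟩, ?_⟩
    rintro N ⟨-, hN⟩ hMN
    exact (hM.eq_of_le hN hMN).ge

theorem isIndependentRingOfKrullType_iff_of_isMaximal
    (hS : ∀ M : Ideal S, M.IsMaximal → M ≠ ⊥ → IsTIdeal M) :
    IsIndependentRingOfKrullType S ↔ IsHLocal S ∧ IsPruferDomain S := by
  have hmax := fun {M : Ideal S} => isMaximalTIdeal_iff_isMaximal hS (M := M)
  have hne : ∀ {a : S} {M : Ideal S}, a ≠ 0 → a ∈ M → M ≠ ⊥ := fun ha haM h0 =>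
    ha (by simpa [h0] using haM)
  rw [isPruferDomain_iff]
  constructor
  · intro h
    refine ⟨⟨fun a ha hu => (h.1.1 a ha hu).subset ?_, fun P hP hP0 => ?_⟩, fun I hI hfg => ?_⟩
    · rintro M ⟨hM, haM⟩
      exact ⟨hmax.2 ⟨hM, hne ha haM⟩, haM⟩
    · obtain ⟨M, hM, hPM⟩ := Ideal.exists_le_maximal P hP.ne_top
      refine ⟨M, ⟨hM, hPM⟩, ?_⟩
      rintro N ⟨hN, hPN⟩
      exact h.1.eq_of_le hP hP0 (hmax.2 ⟨hN, fun h0 => hP0 (le_bot_iff.1 (h0 ▸ hPN))⟩)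
        (hmax.2 ⟨hM, fun h0 => hP0 (le_bot_iff.1 (h0 ▸ hPM))⟩) hPN hPM
    · by_contra htop
      obtain ⟨M, hM, hle⟩ := Ideal.exists_le_maximal _ htop
      have hMt := hS M hM fun h0 => traceIdeal_ne_bot hI (le_bot_iff.1 (h0 ▸ hle))
      have := (tcl_mono hle).trans hMt.tcl_le
      rw [(isTInvertible_iff.1 (h.2 I hI hfg)).2] at this
      exact hM.ne_top (top_le_iff.1 this)
  · rintro ⟨h, hpr⟩
    refine ⟨⟨fun a ha hu => (h.1 a ha hu).subset ?_, fun P hP hPt => ?_⟩, fun I hI hfg => ?_⟩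
    · rintro M ⟨hM, haM⟩
      exact ⟨(hmax.1 hM).1, haM⟩
    · obtain ⟨M, ⟨hM, hPM⟩, huniq⟩ := h.2 P hP hPt.ne_bot
      refine ⟨M, ⟨hmax.2 ⟨hM, fun h0 => hPt.ne_bot (le_bot_iff.1 (h0 ▸ hPM))⟩, hPM⟩, ?_⟩
      rintro N ⟨hN, hPN⟩
      exact huniq N ⟨(hmax.1 hN).1, hPN⟩
    · refine isTInvertible_iff.2 ⟨hI, ?_⟩
      rw [hpr I hI hfg]
      exact top_le_iff.1 (le_tcl _)

theorem IsPruferDomain.tcl_le (hS : IsPruferDomain S) {I : Ideal S} (hI : I ≠ ⊥) : tcl I ≤ I := by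
  intro x hx
  obtain ⟨F, hF, hF0, hFI, hx⟩ := (mem_tcl_iff_exists_ne_bot hI).1 hx
  have hle : traceIdeal F ≤ F.colon (Ideal.span {x}) := by
    rw [traceIdeal, Ideal.span_le]
    rintro y ⟨a, haF, ha, hab⟩
    obtain ⟨c, hc⟩ := hx y a ha hab
    rw [SetLike.mem_coe, Ideal.mem_colon_span_singleton, hc]
    exact F.mul_mem_right c haF
  rw [isPruferDomain_iff.1 hS F hF0 hF, top_le_iff] at hle
  have : (1 : S) * x ∈ F := Ideal.mem_colon_span_singleton.1 (hle ▸ Submodule.mem_top)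
  exact hFI (by simpa using this)

theorem IsTInvertible.exists_fg_ne_bot {I : Ideal S} (hI : IsTInvertible I) :
    ∃ F : Ideal S, F.FG ∧ F ≠ ⊥ ∧ F ≤ I ∧ I ≤ tcl F := by
  obtain ⟨F, hF, hFI, hIF⟩ := hI.exists_fg
  obtain ⟨b, hbI, hb⟩ := Submodule.exists_mem_ne_zero_of_ne_bot hI.1
  refine ⟨F ⊔ Ideal.span {b}, Submodule.FG.sup hF (Submodule.fg_span_singleton b), fun h => ?_,
    sup_le hFI ((Ideal.span_singleton_le_iff_mem _).2 hbI), hIF.trans (tcl_mono le_sup_left)⟩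
  exact hb (by simpa using (sup_eq_bot_iff.1 h).2)

theorem exists_eq_prod_isValuationElement {n : ℕ} {f : Fin n → S}
    (hf : ∀ i, IsValuationIdeal (Ideal.span {f i})) {a : S} (ha : a ≠ 0) (hu : ¬ IsUnit a)
    (h : Associated (∏ i, f i) a) :
    ∃ n : ℕ, 0 < n ∧ ∃ f : Fin n → S, (∀ i, IsValuationElement (f i)) ∧ a = ∏ i, f i := by
  have hne : ∀ i, f i ≠ 0 := by
    intro i hi
    have : ∏ i, f i = 0 := Finset.prod_eq_zero (Finset.mem_univ i) hi
    rw [this, Associated.comm, associated_zero_iff_eq_zero] at h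
    exact ha h
  have key : ∃ s : List S, (∀ x ∈ s, IsValuationElement x) ∧ Associated (∏ i, f i) s.prod := by
    refine Finset.prod_induction f
      (fun b => ∃ s : List S, (∀ x ∈ s, IsValuationElement x) ∧ Associated b s.prod) ?_ ?_ ?_
    · rintro b c ⟨s, hs, hbs⟩ ⟨t, ht, hct⟩
      refine ⟨s ++ t, fun x hx => (List.mem_append.1 hx).elim (hs x) (ht x), ?_⟩
      rw [List.prod_append]
      exact hbs.mul_mul hct
    · exact ⟨[], by simp, by simp⟩
    · intro i _
      by_cases hi : IsUnit (f i)
      · exact ⟨[], by simp, by simpa [associated_one_iff_isUnit] using hi⟩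
      · exact ⟨[f i], by simpa using ⟨hne i, hi, hf i⟩, by simp⟩
  obtain ⟨s, hs, hprod⟩ := key
  obtain ⟨u, hu'⟩ := hprod.symm.trans h
  cases s with
  | nil =>
    rw [List.prod_nil, one_mul] at hu'
    exact absurd (hu' ▸ u.isUnit) hu
  | cons x t =>
    -- Unit factors have been dropped, and the remaining unit `u` is absorbed into the first factor.
    refine ⟨(x * u :: t).length, by simp, fun i => (x * u :: t).get i, fun i => ?_, ?_⟩
    · have hmem := (x * u :: t).get_mem i
      rcases List.mem_cons.1 hmem with h' | h'
      · have hx := hs x (by simp)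
        change IsValuationElement ((x * (u : S) :: t).get i)
        rw [h']
        refine ⟨mul_ne_zero hx.1 u.ne_zero, fun hxu => hx.2.1 (isUnit_of_mul_isUnit_left hxu), ?_⟩
        rw [Ideal.span_singleton_mul_right_unit u.isUnit]
        exact hx.2.2
      · exact hs _ (List.mem_cons_of_mem x h')
    · rw [← List.prod_ofFn, List.ofFn_get, List.prod_cons, ← hu', List.prod_cons]
      ring

/-- The valuation ideals factoring `(a)` are `t`-invertible, hence `t`-closures of finitely
generated ideals. In a Prüfer domain the `t`-closure adds nothing, and Bézout makes them principal.
-/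
theorem IsIndependentRingOfKrullType.isVFD [IsBezout S] (hS : IsIndependentRingOfKrullType S)
    (hpr : IsPruferDomain S) : IsVFD S := by
  intro a ha hu
  have ha' : Ideal.span {a} ≠ ⊥ := by simpa using ha
  obtain ⟨n, -, J, hJ, hJ0, hJa⟩ := (isTProductOfValuationIdeals_iff ha').1
    (hS.isTProductOfValuationIdeals (isTIdeal_span_singleton ha))
  have hprin : ∀ i, ∃ f : S, J i = Ideal.span {f} := by
    intro i
    have hJi : J i ≠ ⊥ := Finset.prod_ne_zero_iff.1 hJ0 i (Finset.mem_univ i)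
    have hinv : IsTInvertible (J i) := by
      rw [← Finset.mul_prod_erase _ _ (Finset.mem_univ i)] at hJa
      exact isTInvertible_of_tcl_mul_eq ha hJi hJa
    obtain ⟨F, hF, hF0, hFJ, hJF⟩ := hinv.exists_fg_ne_bot
    have hFg := IsBezout.isPrincipal_of_FG F hF
    exact ⟨_, (le_antisymm (hJF.trans (hpr.tcl_le hF0)) hFJ).trans hFg.span_singleton_generator.symm⟩
  choose f hf using hprin
  refine exists_eq_prod_isValuationElement (f := f) (fun i => hf i ▸ hJ i) ha hu ?_
  rw [← Ideal.span_singleton_eq_span_singleton, ← Ideal.prod_span_singleton, ← hJa]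
  simp_rw [← hf]
  exact le_antisymm (le_tcl _) (hpr.tcl_le hJ0)

theorem IsVFD.exists_isTInvertible_le (hS : IsVFD S) {P : Ideal S} (hP : P.IsPrime)
    (hP0 : P ≠ ⊥) : ∃ I : Ideal S, IsTInvertible I ∧ IsValuationIdeal I ∧ I ≤ P := by
  obtain ⟨a, haP, ha⟩ := Submodule.exists_mem_ne_zero_of_ne_bot hP0
  obtain ⟨n, -, f, hf, rfl⟩ := hS a ha fun hu => hP.ne_top (Ideal.eq_top_of_isUnit_mem _ haP hu)
  obtain ⟨i, -, hi⟩ := (hP.prod_mem_iff).1 haP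
  refine ⟨Ideal.span {f i}, isTInvertible_of_tcl_mul_eq (J := ⊤) (hf i).1
    (by simpa using (hf i).1) ?_, (hf i).2.2, (Ideal.span_singleton_le_iff_mem _).2 hi⟩
  rw [Ideal.mul_top]
  exact le_antisymm (isTIdeal_span_singleton (hf i).1).tcl_le (le_tcl _)

end MaximalIdealsAreTIdeals

/-! ### The ring `R[X]_{N_v}`. -/

section NagataRing

variable {R : Type*} [CommRing R] [IsDomain R]

/-- The extension of an ideal of `R` to `R[X]_{N_v}`. -/
noncomputable def nagataExtension (I : Ideal R) : Ideal (NvLocalization R) :=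
  (I.map (C : R →+* R[X])).map (algebraMap R[X] (NvLocalization R))

theorem algebraMap_nagata_injective :
    Function.Injective (algebraMap R[X] (NvLocalization R)) :=
  IsLocalization.injective _ (Nv_le_nonZeroDivisors R)

theorem disjoint_Nv_of_le {M : Ideal R} (hM : IsMaximalTIdeal M) {Q : Ideal R[X]}
    (h : Q ≤ M.map C) : Disjoint (Nv R : Set R[X]) (Q : Set R[X]) :=
  Set.disjoint_left.2 fun _ hg hgQ => hM.notMem_Nv (h hgQ) hg

theorem map_comap_nagata (B : Ideal (NvLocalization R)) :
    (B.comap (algebraMap R[X] (NvLocalization R))).map (algebraMap R[X] (NvLocalization R)) = B :=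
  IsLocalization.map_under (Nv R) (NvLocalization R) B

theorem comap_nagata_le_comap_nagata {B B' : Ideal (NvLocalization R)} :
    B.comap (algebraMap R[X] (NvLocalization R)) ≤
      B'.comap (algebraMap R[X] (NvLocalization R)) ↔ B ≤ B' := by
  refine ⟨fun h => ?_, fun h => Ideal.comap_mono h⟩
  rw [← map_comap_nagata B, ← map_comap_nagata B']
  exact Ideal.map_mono h

theorem isPrime_map_nagata {M : Ideal R} (hM : IsMaximalTIdeal M) {Q : Ideal R[X]}
    (hQ : Q.IsPrime) (h : Q ≤ M.map C) :
    (Q.map (algebraMap R[X] (NvLocalization R))).IsPrime :=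
  IsLocalization.isPrime_of_isPrime_disjoint (Nv R) _ Q hQ (disjoint_Nv_of_le hM h)

theorem comap_map_nagata {M : Ideal R} (hM : IsMaximalTIdeal M) {Q : Ideal R[X]}
    (hQ : Q.IsPrime) (h : Q ≤ M.map C) :
    (Q.map (algebraMap R[X] (NvLocalization R))).comap (algebraMap R[X] (NvLocalization R)) = Q :=
  IsLocalization.under_map_of_isPrime_disjoint (Nv R) _ hQ (disjoint_Nv_of_le hM h)

theorem comap_nagataExtension {M : Ideal R} (hM : IsMaximalTIdeal M) :
    (nagataExtension M).comap (algebraMap R[X] (NvLocalization R)) = M.map C :=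
  comap_map_nagata hM hM.map_C.isPrime le_rfl

theorem nagataExtension_injOn :
    Set.InjOn (nagataExtension (R := R)) {M | IsMaximalTIdeal M} := by
  intro M hM N hN h
  rw [← comap_map_C M, ← comap_map_C N, ← comap_nagataExtension hM, ← comap_nagataExtension hN, h]

theorem exists_comap_nagata_le {B : Ideal (NvLocalization R)} (hB : B ≠ ⊥) (hB' : B ≠ ⊤) :
    ∃ M : Ideal R, IsMaximalTIdeal M ∧
      B.comap (algebraMap R[X] (NvLocalization R)) ≤ M.map C := by
  refine exists_le_map_C_of_forall_notMem_Nv (fun h0 => hB ?_) fun g hg hgN => hB' ?_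
  · rw [← map_comap_nagata B, h0, Ideal.map_bot]
  · exact Ideal.eq_top_of_isUnit_mem _ hg (IsLocalization.map_units (NvLocalization R) ⟨g, hgN⟩)

theorem nagataExtension_ne_bot {I : Ideal R} (hI : I ≠ ⊥) : nagataExtension I ≠ ⊥ := by
  rw [nagataExtension, Ne, Ideal.map_eq_bot_iff_of_injective algebraMap_nagata_injective]
  exact map_C_ne_bot hI

theorem isMaximal_nagataExtension {M : Ideal R} (hM : IsMaximalTIdeal M) :
    (nagataExtension M).IsMaximal := by
  have hprime : (nagataExtension M).IsPrime := isPrime_map_nagata hM hM.map_C.isPrime le_rfl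
  refine Ideal.isMaximal_def.2 ⟨hprime.ne_top, fun B hlt => ?_⟩
  by_contra hB
  obtain ⟨N, hN, hBN⟩ := exists_comap_nagata_le
    (fun h0 => nagataExtension_ne_bot hM.isTIdeal.ne_bot (le_bot_iff.1 (h0 ▸ hlt.le))) hB
  have hMB := Ideal.comap_mono (f := algebraMap R[X] (NvLocalization R)) hlt.le
  rw [comap_nagataExtension hM] at hMB
  have := hM.eq_of_le hN.isTIdeal hN.ne_top (map_C_le_map_C.1 (hMB.trans hBN))
  subst this
  rw [← comap_nagataExtension hM, comap_nagata_le_comap_nagata] at hBN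
  exact hlt.not_ge hBN

theorem exists_eq_nagataExtension {B : Ideal (NvLocalization R)} (hB : B.IsMaximal)
    (hB0 : B ≠ ⊥) : ∃ M : Ideal R, IsMaximalTIdeal M ∧ B = nagataExtension M := by
  obtain ⟨M, hM, hBM⟩ := exists_comap_nagata_le hB0 hB.ne_top
  rw [← comap_nagataExtension hM, comap_nagata_le_comap_nagata] at hBM
  exact ⟨M, hM, hB.eq_of_le (isMaximal_nagataExtension hM).ne_top hBM⟩

theorem exists_algebraMap_eq_mul_unit (x : NvLocalization R) :
    ∃ f : R[X], ∃ u : (NvLocalization R)ˣ, algebraMap R[X] (NvLocalization R) f = x * u := by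
  obtain ⟨⟨f, s⟩, h⟩ := IsLocalization.surj (Nv R) x
  exact ⟨f, (IsLocalization.map_units (NvLocalization R) s).unit, h.symm⟩

theorem exists_dvd_mul_of_algebraMap_dvd {f g : R[X]}
    (h : algebraMap R[X] (NvLocalization R) f ∣ algebraMap R[X] (NvLocalization R) g) :
    ∃ s ∈ Nv R, f ∣ s * g := by
  obtain ⟨x, hx⟩ := h
  obtain ⟨⟨k, s⟩, hk⟩ := IsLocalization.surj (Nv R) x
  refine ⟨s, s.2, k, algebraMap_nagata_injective ?_⟩
  rw [map_mul, map_mul, hx, ← hk]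
  ring

theorem isTIdeal_nagataExtension {M : Ideal R} (hM : IsMaximalTIdeal M) :
    IsTIdeal (nagataExtension M) := by
  have hmax := isMaximal_nagataExtension hM
  refine isTIdeal_iff.2 ⟨nagataExtension_ne_bot hM.isTIdeal.ne_bot, ?_⟩
  refine (hmax.eq_of_le (fun htop => ?_) (le_tcl _)).ge
  obtain ⟨F, hF, hFM, h1⟩ : (1 : NvLocalization R) ∈ tcl (nagataExtension M) :=
    htop ▸ Submodule.mem_top
  have hG : ∃ G : Ideal R[X], G.FG ∧ G ≤ M.map C ∧
      F ≤ G.map (algebraMap R[X] (NvLocalization R)) := by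
    clear h1
    induction F, hF using Submodule.fg_induction with
    | singleton x =>
      obtain ⟨f, u, hfu⟩ := exists_algebraMap_eq_mul_unit x
      refine ⟨Ideal.span {f}, Submodule.fg_span_singleton f, ?_, ?_⟩
      · rw [Ideal.span_singleton_le_iff_mem, ← comap_nagataExtension hM, Ideal.mem_comap, hfu]
        exact Ideal.mul_mem_right _ _ (hFM (Submodule.mem_span_singleton_self x))
      · rw [Ideal.map_span, Set.image_singleton, hfu, Ideal.span_singleton_mul_right_unit u.isUnit]
    | sup F₁ F₂ _ _ h₁ h₂ =>
      obtain ⟨G₁, hG₁, hGI₁, hle₁⟩ := h₁ (le_sup_left.trans hFM)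
      obtain ⟨G₂, hG₂, hGI₂, hle₂⟩ := h₂ (le_sup_right.trans hFM)
      exact ⟨G₁ ⊔ G₂, Submodule.FG.sup hG₁ hG₂, sup_le hGI₁ hGI₂,
        sup_le (hle₁.trans (Ideal.map_mono le_sup_left))
          (hle₂.trans (Ideal.map_mono le_sup_right))⟩
  obtain ⟨G, hG, hGM, hFG⟩ := hG
  obtain ⟨E, hE, hEM, hGE⟩ := exists_fg_le_map_C hG hGM
  refine hM.ne_top ((Ideal.eq_top_iff_one _).2 (hM.isTIdeal.tcl_le ⟨E, hE, hEM, ?_⟩))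
  -- Here `1 ∈ E_v` is shown: `rE ⊆ (s)` forces `s ∣ r` in the localization, so `s` divides `r g`
  -- with `g ∈ N_v`, and hence `r`.
  intro r s hs h
  have hs' : algebraMap R[X] (NvLocalization R) (C s) ≠ 0 :=
    (map_ne_zero_iff _ algebraMap_nagata_injective).2 (C_ne_zero.2 hs)
  have hle : F ≤ (Ideal.span {algebraMap R[X] (NvLocalization R) (C s)}).colon
      (Ideal.span {algebraMap R[X] (NvLocalization R) (C r)}) := by
    refine hFG.trans ((Ideal.map_mono hGE).trans ?_)
    rw [Ideal.map_map, Ideal.map_le_iff_le_comap]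
    intro b hb
    rw [Ideal.mem_comap, Ideal.mem_colon_span_singleton, Ideal.mem_span_singleton,
      RingHom.comp_apply, ← map_mul, ← C_mul]
    have hsb : s ∣ b * r := by
      rw [mul_comm]
      exact h b hb
    exact map_dvd (algebraMap R[X] (NvLocalization R)) (map_dvd C hsb)
  have h2 : algebraMap R[X] (NvLocalization R) (C s) ∣ algebraMap R[X] (NvLocalization R) (C r) := by
    have := h1 (algebraMap R[X] (NvLocalization R) (C r)) _ hs' fun b hb => by
      have := Ideal.mem_span_singleton.1 (Ideal.mem_colon_span_singleton.1 (hle hb))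
      rwa [mul_comm b] at this
    rwa [mul_one] at this
  obtain ⟨g, hg, hd⟩ := exists_dvd_mul_of_algebraMap_dvd h2
  rw [mul_comm] at hd
  rw [mul_one]
  simpa using (C_dvd_iff_dvd_coeff _ _).1 (C_dvd_of_C_dvd_mul hg hs hd) 0

theorem isTIdeal_of_isMaximal_nagata (B : Ideal (NvLocalization R)) (hB : B.IsMaximal)
    (hB0 : B ≠ ⊥) : IsTIdeal B := by
  obtain ⟨M, hM, rfl⟩ := exists_eq_nagataExtension hB hB0
  exact isTIdeal_nagataExtension hM

theorem isMaximalTIdeal_nagata_iff {B : Ideal (NvLocalization R)} :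
    IsMaximalTIdeal B ↔ ∃ M : Ideal R, IsMaximalTIdeal M ∧ B = nagataExtension M := by
  rw [isMaximalTIdeal_iff_isMaximal isTIdeal_of_isMaximal_nagata]
  constructor
  · rintro ⟨hB, hB0⟩
    exact exists_eq_nagataExtension hB hB0
  · rintro ⟨M, hM, rfl⟩
    exact ⟨isMaximal_nagataExtension hM, nagataExtension_ne_bot hM.isTIdeal.ne_bot⟩

theorem algebraMap_mem_nagataExtension {M : Ideal R} (hM : IsMaximalTIdeal M) {f : R[X]} :
    algebraMap R[X] (NvLocalization R) f ∈ nagataExtension M ↔ f ∈ M.map C := by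
  rw [← comap_nagataExtension hM, Ideal.mem_comap]

/-- Localizing `R[X]_{N_v}` at the extension of `M` gives the localization of `R[X]` at `M[X]`. -/
theorem isValuationAt_nagataExtension_iff {M : Ideal R} (hM : IsMaximalTIdeal M) :
    IsValuationAt (nagataExtension M) ↔ IsValuationAt M := by
  have hMp := hM.isPrime
  have hMXp := hM.map_C.isPrime
  have hp : (nagataExtension M).IsPrime := (isMaximal_nagataExtension hM).isPrime
  have key : ∀ {f g : R[X]}, DvdAt (nagataExtension M) (algebraMap R[X] (NvLocalization R) f)
      (algebraMap R[X] (NvLocalization R) g) ↔ DvdAt (M.map C) f g := by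
    intro f g
    constructor
    · rintro ⟨x, hx, hd⟩
      obtain ⟨s, u, hsu⟩ := exists_algebraMap_eq_mul_unit x
      have hsM : s ∉ M.map C := by
        rw [← algebraMap_mem_nagataExtension hM, hsu]
        exact hp.mul_notMem hx fun hu => hp.ne_top (Ideal.eq_top_of_isUnit_mem _ hu u.isUnit)
      obtain ⟨t, ht, hd'⟩ := exists_dvd_mul_of_algebraMap_dvd (f := f) (g := s * g) (by
        rw [map_mul, hsu, mul_right_comm]
        exact hd.mul_right _)
      refine ⟨t * s, hMXp.mul_notMem (fun h => hM.notMem_Nv h ht) hsM, ?_⟩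
      rwa [mul_assoc]
    · rintro ⟨s, hs, hd⟩
      refine ⟨algebraMap R[X] (NvLocalization R) s,
        fun h => hs ((algebraMap_mem_nagataExtension hM).1 h), ?_⟩
      rw [← map_mul]
      exact map_dvd _ hd
  constructor
  · intro h
    refine IsValuationAt.of_map_C fun f g => ?_
    exact (h (algebraMap R[X] (NvLocalization R) f) (algebraMap R[X] (NvLocalization R) g)).imp
      key.1 key.1
  · intro h x y
    obtain ⟨f, u, hf⟩ := exists_algebraMap_eq_mul_unit x
    obtain ⟨g, v, hg⟩ := exists_algebraMap_eq_mul_unit y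
    have hunit : ∀ {x y : NvLocalization R} {u v : (NvLocalization R)ˣ},
        DvdAt (nagataExtension M) (x * u) (y * v) → DvdAt (nagataExtension M) x y := by
      rintro x y u v ⟨s, hs, hd⟩
      refine ⟨s, hs, ?_⟩
      rw [← mul_assoc, Units.dvd_mul_right] at hd
      exact (dvd_mul_right x u).trans hd
    refine (h.map_C f g).imp (fun h' => ?_) (fun h' => ?_)
    · have := key.2 h'
      rw [hf, hg] at this
      exact hunit this
    · have := key.2 h'
      rw [hf, hg] at this
      exact hunit this

theorem isPvMD_nagata_iff : IsPvMD (NvLocalization R) ↔ IsPvMD R := by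
  rw [isPvMD_iff, isPvMD_iff]
  constructor
  · intro h M hM
    exact (isValuationAt_nagataExtension_iff hM).1 (h _ (isMaximalTIdeal_nagata_iff.2 ⟨M, hM, rfl⟩))
  · intro h B hB
    obtain ⟨M, hM, rfl⟩ := isMaximalTIdeal_nagata_iff.1 hB
    exact (isValuationAt_nagataExtension_iff hM).2 (h M hM)

theorem IsIndependentRingOfKrullType.nagata (hR : IsIndependentRingOfKrullType R) :
    IsIndependentRingOfKrullType (NvLocalization R) := by
  refine ⟨⟨fun x hx _ => ?_, fun Q hQ hQt => ?_⟩, isPvMD_nagata_iff.2 hR.2⟩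
  · obtain ⟨f, u, hf⟩ := exists_algebraMap_eq_mul_unit x
    have hf0 : f ≠ 0 := by
      rintro rfl
      rw [map_zero] at hf
      exact mul_ne_zero hx u.ne_zero hf.symm
    refine ((hR.1.finite_setOf_mem_map_C hf0).image nagataExtension).subset ?_
    rintro B ⟨hB, hxB⟩
    obtain ⟨M, hM, rfl⟩ := isMaximalTIdeal_nagata_iff.1 hB
    refine ⟨M, ⟨hM, ?_⟩, rfl⟩
    rw [← algebraMap_mem_nagataExtension hM, hf]
    exact Ideal.mul_mem_right _ _ hxB
  · obtain ⟨B, hB, hQB⟩ := exists_isMaximalTIdeal hQt hQ.ne_top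
    refine ⟨B, ⟨hB, hQB⟩, ?_⟩
    rintro B' ⟨hB', hQB'⟩
    obtain ⟨M, hM, rfl⟩ := isMaximalTIdeal_nagata_iff.1 hB
    obtain ⟨N, hN, rfl⟩ := isMaximalTIdeal_nagata_iff.1 hB'
    rw [← comap_nagata_le_comap_nagata, comap_nagataExtension hM] at hQB
    rw [← comap_nagata_le_comap_nagata, comap_nagataExtension hN] at hQB'
    rw [hR.1.eq_of_le_map_C hR.2.isUMT (hQ.comap _) (fun h0 => hQt.ne_bot (by
      rw [← map_comap_nagata Q, h0, Ideal.map_bot])) hM hN hQB hQB']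

theorem IsIndependentRingOfKrullType.of_nagata
    (hR : IsIndependentRingOfKrullType (NvLocalization R)) : IsIndependentRingOfKrullType R := by
  have hmax : ∀ {M : Ideal R}, IsMaximalTIdeal M → IsMaximalTIdeal (nagataExtension M) :=
    fun hM => isMaximalTIdeal_nagata_iff.2 ⟨_, hM, rfl⟩
  refine ⟨⟨fun a ha _ => ?_, fun P hP hPt => ?_⟩, isPvMD_nagata_iff.1 hR.2⟩
  · have ha' : algebraMap R[X] (NvLocalization R) (C a) ≠ 0 :=
      (map_ne_zero_iff _ algebraMap_nagata_injective).2 (C_ne_zero.2 ha)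
    have hmem : ∀ {M : Ideal R}, IsMaximalTIdeal M → a ∈ M →
        algebraMap R[X] (NvLocalization R) (C a) ∈ nagataExtension M := fun hM haM =>
      (algebraMap_mem_nagataExtension hM).2 (Ideal.mem_map_of_mem C haM)
    by_cases hu : IsUnit (algebraMap R[X] (NvLocalization R) (C a))
    · refine Set.finite_empty.subset ?_
      rintro M ⟨hM, haM⟩
      exact (hmax hM).ne_top (Ideal.eq_top_of_isUnit_mem _ (hmem hM haM) hu)
    · refine Set.Finite.of_finite_image (f := nagataExtension) ((hR.1.1 _ ha' hu).subset ?_)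
        (nagataExtension_injOn.mono fun M hM => hM.1)
      rintro _ ⟨M, ⟨hM, haM⟩, rfl⟩
      exact ⟨hmax hM, hmem hM haM⟩
  · obtain ⟨M, hM, hPM⟩ := exists_isMaximalTIdeal hPt hP.ne_top
    refine ⟨M, ⟨hM, hPM⟩, ?_⟩
    rintro N ⟨hN, hPN⟩
    refine nagataExtension_injOn hN hM (hR.1.eq_of_le
      (isPrime_map_nagata hM Ideal.isPrime_map_C_of_isPrime (Ideal.map_mono hPM))
      (nagataExtension_ne_bot hPt.ne_bot) (hmax hN) (hmax hM) ?_ ?_)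
    · exact Ideal.map_mono (Ideal.map_mono hPN)
    · exact Ideal.map_mono (Ideal.map_mono hPM)

theorem algebraMap_dvd_of_contentIdeal_le (hR : IsPvMD R) {f h : R[X]} (h0 : h ≠ 0)
    (hfh : f.contentIdeal ≤ h.contentIdeal) :
    algebraMap R[X] (NvLocalization R) h ∣ algebraMap R[X] (NvLocalization R) f := by
  have h0' : algebraMap R[X] (NvLocalization R) h ≠ 0 :=
    (map_ne_zero_iff _ algebraMap_nagata_injective).2 h0
  set B := (Ideal.span {algebraMap R[X] (NvLocalization R) h}).colon
    (Ideal.span {algebraMap R[X] (NvLocalization R) f}) with hB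
  have hmemB : ∀ y, y ∈ B ↔
      algebraMap R[X] (NvLocalization R) h ∣ y * algebraMap R[X] (NvLocalization R) f := by
    intro y
    rw [hB, Ideal.mem_colon_span_singleton, Ideal.mem_span_singleton]
  by_cases htop : B = ⊤
  · simpa using (hmemB 1).1 (htop ▸ Submodule.mem_top)
  · obtain ⟨M, hM, hBM⟩ := Ideal.exists_le_maximal _ htop
    have hhM := hBM ((hmemB _).2 (dvd_mul_right _ _))
    obtain ⟨P, hP, rfl⟩ := exists_eq_nagataExtension hM fun hb => h0' (by simpa [hb] using hhM)
    have hPp := hP.isPrime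
    obtain ⟨s, hs, hd⟩ := (isPvMD_iff.1 hR P hP).dvdAt_map_C h0 P.one_notMem
      (f := f) fun b hb => by rw [one_mul]; exact hfh hb
    refine absurd ((algebraMap_mem_nagataExtension hP).1 (hBM ((hmemB _).2 ?_))) hs
    rw [← map_mul]
    exact map_dvd _ hd

/-- Over a P`v`MD, divisibility in `R[X]_{N_v}` follows from inclusion of contents, so `f + g X^(deg
f + 1)` divides both `f` and `g`. -/
theorem IsPvMD.isBezout_nagata (hR : IsPvMD R) : IsBezout (NvLocalization R) := by
  rw [IsBezout.iff_span_pair_isPrincipal]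
  intro x y
  obtain ⟨f, u, hf⟩ := exists_algebraMap_eq_mul_unit x
  obtain ⟨g, v, hg⟩ := exists_algebraMap_eq_mul_unit y
  have hle := contentIdeal_sup_le f g
  set h := f + g * X ^ (f.natDegree + 1) with hh
  by_cases h0 : h = 0
  · rw [h0, contentIdeal_zero, le_bot_iff, sup_eq_bot_iff, contentIdeal_eq_bot_iff,
      contentIdeal_eq_bot_iff] at hle
    have hx : x = 0 := by
      rw [hle.1, map_zero] at hf
      exact (mul_eq_zero.1 hf.symm).resolve_right u.ne_zero
    have hy : y = 0 := by
      rw [hle.2, map_zero] at hg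
      exact (mul_eq_zero.1 hg.symm).resolve_right v.ne_zero
    exact ⟨0, by simp [hx, hy]⟩
  · refine ⟨algebraMap R[X] (NvLocalization R) h, ?_⟩
    change Ideal.span {x, y} = Ideal.span {_}
    apply le_antisymm
    · rw [Ideal.span_le]
      rintro z (rfl | rfl)
      · rw [SetLike.mem_coe, Ideal.mem_span_singleton, ← Units.dvd_mul_right (u := u), ← hf]
        exact algebraMap_dvd_of_contentIdeal_le hR h0 (le_sup_left.trans hle)
      · rw [SetLike.mem_coe, Ideal.mem_span_singleton, ← Units.dvd_mul_right (u := v), ← hg]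
        exact algebraMap_dvd_of_contentIdeal_le hR h0 (le_sup_right.trans hle)
    · rw [Ideal.span_singleton_le_iff_mem, hh, map_add, map_mul, hf, hg]
      exact add_mem (Ideal.mul_mem_right _ _ (Ideal.subset_span (by simp)))
        (Ideal.mul_mem_right _ _ (Ideal.mul_mem_right _ _ (Ideal.subset_span (by simp))))

/-- Each prime involved contracts to a prime of `R[X]` inside some `N[X]`, and UMT makes it extended
from `R`, where primes inside `N` form a chain. -/
theorem IsTTreed.nagata (hR : IsTTreed R) (hUMT : IsUMT R) : IsTTreed (NvLocalization R) := by
  intro P Q M hP hQ hM hPt hQt hMt hPM hQM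
  obtain ⟨N, hN, hMN⟩ := exists_comap_nagata_le hMt.ne_bot hM.ne_top
  rw [← comap_nagata_le_comap_nagata] at hPM hQM
  rw [← comap_nagata_le_comap_nagata, ← comap_nagata_le_comap_nagata (B := Q)]
  have hN0 : (N.map (C : R →+* R[X])).comap C ≠ ⊥ := by
    rw [comap_map_C]
    exact hN.isTIdeal.ne_bot
  have hle : ∀ {B : Ideal R[X]}, B ≤ N.map C → B.comap C ≤ N := fun h => by
    rw [← comap_map_C N]
    exact Ideal.comap_mono h
  have hPp := hP.comap (algebraMap R[X] (NvLocalization R))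
  have hQp := hQ.comap (algebraMap R[X] (NvLocalization R))
  rw [hUMT.eq_map_C hPp hN.map_C.isTIdeal hN.map_C.ne_top (hPM.trans hMN) hN0,
    hUMT.eq_map_C hQp hN.map_C.isTIdeal hN.map_C.ne_top (hQM.trans hMN) hN0,
    map_C_le_map_C, map_C_le_map_C]
  exact hR.le_or_le hN.isPrime hN.isTIdeal (hPp.comap C) (hQp.comap C)
    (hle (hPM.trans hMN)) (hle (hQM.trans hMN))

end NagataRing

end TIdeals

/-! ### Assembly of the equivalences. -/

theorem theorem4p5 (D : Type*) [CommRing D] [IsDomain D] (hD : IsTTreed D) :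
    List.TFAE [
      ∀ I : Ideal D, IsTIdeal I → IsTProductOfValuationIdeals I,
      IsTVIFD D,
      IsIndependentRingOfKrullType D,
      IsIndependentRingOfKrullType D[X],
      IsTVIFD D[X] ∧ IsUMT D,
      IsVFD (NvLocalization D) ∧ IsUMT D,
      IsHLocal (NvLocalization D) ∧ IsPruferDomain (NvLocalization D),
      ∀ P : Ideal D, P.IsPrime → P ≠ ⊥ →
        ∃ I : Ideal D, IsTInvertible I ∧ IsValuationIdeal I ∧ I ≤ P] := by
  have h7 := isIndependentRingOfKrullType_iff_of_isMaximal
    (isTIdeal_of_isMaximal_nagata (R := D))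
  tfae_have 1 → 2 := isTVIFD_of_forall
  tfae_have 2 → 8 := fun h _ hP hP0 => h.exists_isTInvertible_le hP hP0
  tfae_have 8 → 3 := isIndependentRingOfKrullType_of_isTTreed hD
  tfae_have 3 → 1 := fun h _ hI => h.isTProductOfValuationIdeals hI
  tfae_have 3 → 4 := fun h => h.polynomial
  tfae_have 4 → 5 := fun h => ⟨isTVIFD_of_forall fun _ hI => h.isTProductOfValuationIdeals hI,
    h.of_polynomial.2.isUMT⟩
  tfae_have 5 → 3 := fun h => (isIndependentRingOfKrullType_of_isTTreed (hD.polynomial h.2)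
    fun _ hP hP0 => h.1.exists_isTInvertible_le hP hP0).of_polynomial
  tfae_have 3 → 7 := fun h => h7.1 h.nagata
  tfae_have 7 → 6 := fun h => by
    have hN := h7.2 h
    have hD3 := hN.of_nagata
    have := hD3.2.isBezout_nagata
    exact ⟨hN.isVFD h.2, hD3.2.isUMT⟩
  tfae_have 6 → 3 := fun h => (isIndependentRingOfKrullType_of_isTTreed (hD.nagata h.2)
    fun _ hP hP0 => h.1.exists_isTInvertible_le hP hP0).of_nagata
  tfae_finish
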